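/- Let $W$ be a (real or complex) Banach space and let $(S(t))_{t\ge 0}$ be an analytic $C_0$-semigroup on $W$ with generator $A$. Fix $\omega\in\mathbb{R}$ strictly larger than the growth bound of $S$, i.e. $\|S(t)\|\le Me^{\omega' t}$ for all $t\ge 0$ with some $M$ and some $\omega'<\omega$ (so $\omega=0$ is allowed if $S$ is exponentially stable). For $\varepsilon\ge 0$ let $D_\varepsilon=D((\omega-A)^{\varepsilon})$ with $|x|_{D_\varepsilon}=|(\omega-A)^{\varepsilon}x|$, where $(\omega-A)^{\varepsilon}$ is the inverse of the injective operator $(\omega-A)^{-\varepsilon}x=\frac1{\Gamma(\varepsilon)}\int_0^\infty r^{\varepsilon-1}e^{-\omega r}S(r)x\,dr$ for $\varepsilon>0$, and $(\omega-A)^0=\mathrm{Id}$. For $y:[0,T]\to W$ and $z$ defined on pairs of times write $$(\delta y)_{ts}=y_t-y_s,\quad (\hat\delta y)_{ts}=y_t-S(t-s)y_s,\quad (\hat\delta_2 z)_{t\tau s}=z_{ts}-z_{t\tau}-S(t-\tau)z_{\tau s}.$$ Let $0<\alpha\le 1$, $0\le\beta\le 1$, $\rho>1$ and $\alpha+\beta\le\rho$.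 Let $T>0$, $c_1,c_2\in\mathbb{R}$, and let $\Xi$ be a $W$-valued map defined for $0\le u\le v\le T$, continuous on $\{(v,u):0\le u<v\le T\}$, with $$|\Xi_{vu}|\le c_1(v-u)^\alpha\quad(0\le u\le v\le T),\qquad |(\hat\delta_2\Xi)_{vmu}|\le c_2\,u^{-\beta}(v-u)^\rho\quad(0<u\le m\le v\le T).$$ Then there is a unique $\mathcal I\Xi\in C([0,T],W)$ such that $\mathcal I\Xi_0=0$ and, for some constant $K$, $$|(\hat\delta\mathcal I\Xi)_{ts}|\le K(c_1+c_2)(t-s)^\alpha\ (0\le s\le t\le T),\qquad |(\hat\delta\mathcal I\Xi)_{ts}-\Xi_{ts}|\le Kc_2\,s^{-\beta}(t-s)^\rho\ (0<s\le t\le T).$$ Moreover, for every $T_0$ the following estimates hold for all $0<T\le T_0$ and all $\Xi,c_1,c_2$ as above, with constants $C$ that depend only on $S,\omega,\alpha,\beta,\rho,T_0$ and on $\varepsilon$, respectively $\gamma$ (not on $T$, $\Xi$, $c_1$, $c_2$): 1. for every $0\le\varepsilon<\alpha$ and all $0\le s\le t\le T$: $(\hat\delta\mathcal I\Xi)_{ts}\in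 D_\varepsilon$ and $|(\hat\delta\mathcal I\Xi)_{ts}|_{D_\varepsilon}\le C(c_1+c_2)(t-s)^{\alpha-\varepsilon}$; 2. for every real $\gamma<\alpha$ and all $0\le s\le t\le T$ (with $s<t$ if $\gamma<0$): $|(\delta\mathcal I\Xi)_{ts}|\le C(c_1+c_2)(t-s)^\gamma T^{\alpha-\gamma}$; 3. for every $0\le\gamma<\alpha$: $\|\mathcal I\Xi\|_{\gamma}\le C(c_1+c_2)T^{\alpha-\gamma}$ and $\|\mathcal I\Xi\|_{\gamma,\gamma}\le C(c_1+c_2)T^{\alpha}$, where $$\|y\|_\gamma=\sup_{0\le t\le T}|y_t|+\sup_{0\le s<t\le T}\frac{|y_t-y_s|}{(t-s)^\gamma},\qquad \|y\|_{\gamma,\gamma}=\sup_{0\le t\le T}|y_t|+\sup_{0<s<t\le T}s^\gamma\frac{|y_t-y_s|}{(t-s)^\gamma}.$$ -/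

import Mathlib

open Set Filter Topology MeasureTheory
open scoped ENNReal

noncomputable section

namespace MildSewing

universe u

/-- Strongly continuous semigroup `(S t)_{t ≥ 0}` of bounded operators. Only the values of `S` at
nonnegative times matter. A complex Banach space is covered by restriction of scalars. -/
structure IsC0Semigroup {W : Type u} [NormedAddCommGroup W] [NormedSpace ℝ W]
    (S : ℝ → W →L[ℝ] W) : Prop where
  map_zero : S 0 = ContinuousLinearMap.id ℝ W
  map_add : ∀ s t : ℝ, 0 ≤ s → 0 ≤ t → S (s + t) = (S s).comp (S t)
  tendsto_zero : ∀ x : W, Tendsto (fun t : ℝ => S t x) (𝓝[>] 0) (𝓝 x)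

/-- The open sector `{z ≠ 0 : |arg z| < θ}`. -/
def sector (θ : ℝ) : Set ℂ := {z : ℂ | z ≠ 0 ∧ |z.arg| < θ}

/-- An analytic semigroup of bounded operators on a complex Banach space, in the sector of
half-angle `θ ∈ (0, π/2]`. -/
structure IsSectorialSemigroup {E : Type u} [NormedAddCommGroup E] [NormedSpace ℂ E]
    (θ : ℝ) (U : ℂ → E →L[ℂ] E) : Prop where
  angle_pos : 0 < θ
  angle_le : θ ≤ Real.pi / 2
  map_add : ∀ z ∈ sector θ, ∀ w ∈ sector θ, U (z + w) = (U z).comp (U w)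
  holomorphic : DifferentiableOn ℂ U (sector θ)
  tendsto_zero : ∀ x : E, Tendsto (fun z : ℂ => U z x) (𝓝[sector θ] 0) (𝓝 x)

/-- Analytic `C₀`-semigroup. Analyticity means that `S` extends to an analytic semigroup in a
sector. If `W` is a real space, then this extension lives on a complexification `E` of `W`
(with embedding `ι`); if `W` is a complex space, one can take `E = W` and `ι = id`. -/
structure IsAnalyticSemigroup {W : Type u} [NormedAddCommGroup W] [NormedSpace ℝ W]
    (S : ℝ → W →L[ℝ] W) : Prop extends IsC0Semigroup S where
  analytic : ∃ (E : Type u) (_ : NormedAddCommGroup E) (_ : NormedSpace ℂ E) (_ : CompleteSpace E)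
    (ι : W →ₗᵢ[ℝ] E) (θ : ℝ) (U : ℂ → E →L[ℂ] E),
    (∀ e : E, ∃ x y : W, e = ι x + Complex.I • ι y) ∧
    IsSectorialSemigroup θ U ∧
    ∀ t : ℝ, 0 < t → ∀ x : W, U (t : ℂ) (ι x) = ι (S t x)

/-- `ω` is strictly larger than the growth bound of the semigroup, i.e. `e^{-ωt} S(t)` decays
exponentially. For an exponentially stable semigroup `ω = 0` is allowed. -/
def GrowthBoundLT {W : Type u} [NormedAddCommGroup W] [NormedSpace ℝ W]
    (S : ℝ → W →L[ℝ] W) (ω : ℝ) : Prop :=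
  ∃ M ω' : ℝ, ω' < ω ∧ ∀ t : ℝ, 0 ≤ t → ‖S t‖ ≤ M * Real.exp (ω' * t)

/-- The negative fractional power `(ω - A)^{-ε}`, where `A` is the generator of `S`:
`(ω - A)^{-ε} x = Γ(ε)⁻¹ ∫₀^∞ t^{ε-1} e^{-ωt} S(t) x dt` for `ε > 0`, and `(ω - A)^0 = Id`. -/
def negFracPow {W : Type u} [NormedAddCommGroup W] [NormedSpace ℝ W]
    (S : ℝ → W →L[ℝ] W) (ω ε : ℝ) (x : W) : W :=
  if ε = 0 then x
  else (Real.Gamma ε)⁻¹ • ∫ t in Ioi (0 : ℝ), (t ^ (ε - 1) * Real.exp (-(ω * t))) • S t x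

/-- The domain `D_ε` of `(ω - A)^ε`, i.e. the range of `(ω - A)^{-ε}`. -/
def fracDomain {W : Type u} [NormedAddCommGroup W] [NormedSpace ℝ W]
    (S : ℝ → W →L[ℝ] W) (ω ε : ℝ) : Set W :=
  Set.range (negFracPow S ω ε)

/-- The fractional power `(ω - A)^ε`, the inverse of the injective operator `(ω - A)^{-ε}`
(only its values on `D_ε` are meaningful). -/
def fracPow {W : Type u} [NormedAddCommGroup W] [NormedSpace ℝ W]
    (S : ℝ → W →L[ℝ] W) (ω ε : ℝ) : W → W :=
  Function.invFun (negFracPow S ω ε)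

/-- The norm `|x|_{D_ε} = |(ω - A)^ε x|` of `x ∈ D_ε`. -/
def fracNorm {W : Type u} [NormedAddCommGroup W] [NormedSpace ℝ W]
    (S : ℝ → W →L[ℝ] W) (ω ε : ℝ) (x : W) : ℝ :=
  ‖fracPow S ω ε x‖

/-- `(δ y)_{ts} = y_t - y_s`. -/
def delta {W : Type u} [NormedAddCommGroup W] (y : ℝ → W) (t s : ℝ) : W := y t - y s

/-- `(δ̂ y)_{ts} = y_t - S(t-s) y_s`. -/
def hatDelta {W : Type u} [NormedAddCommGroup W] [NormedSpace ℝ W]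
    (S : ℝ → W →L[ℝ] W) (y : ℝ → W) (t s : ℝ) : W :=
  y t - S (t - s) (y s)

/-- `(δ̂₂ z)_{tτs} = z_{ts} - z_{tτ} - S(t-τ) z_{τs}`. -/
def hatDelta₂ {W : Type u} [NormedAddCommGroup W] [NormedSpace ℝ W]
    (S : ℝ → W →L[ℝ] W) (z : ℝ → ℝ → W) (t τ s : ℝ) : W :=
  z t s - z t τ - S (t - τ) (z τ s)

/-- The hypotheses of the Sewing Lemma on the approximation term `Ξ`. -/
structure IsApproximationTerm {W : Type u} [NormedAddCommGroup W] [NormedSpace ℝ W]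
    (S : ℝ → W →L[ℝ] W) (T α β ρ c₁ c₂ : ℝ) (Ξ : ℝ → ℝ → W) : Prop where
  continuousOn : ContinuousOn (fun p : ℝ × ℝ => Ξ p.1 p.2)
    {p : ℝ × ℝ | 0 ≤ p.2 ∧ p.2 < p.1 ∧ p.1 ≤ T}
  bound : ∀ u v : ℝ, 0 ≤ u → u ≤ v → v ≤ T → ‖Ξ v u‖ ≤ c₁ * (v - u) ^ α
  hatDelta₂_bound : ∀ u m v : ℝ, 0 < u → u ≤ m → m ≤ v → v ≤ T →
    ‖hatDelta₂ S Ξ v m u‖ ≤ c₂ * u ^ (-β) * (v - u) ^ ρ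

/-- `I` has the properties that characterize the path `𝓘Ξ` of the Sewing Lemma on `[0,T]`. -/
structure IsSewing {W : Type u} [NormedAddCommGroup W] [NormedSpace ℝ W]
    (S : ℝ → W →L[ℝ] W) (T α β ρ c₁ c₂ : ℝ) (Ξ : ℝ → ℝ → W) (I : ℝ → W) : Prop where
  continuousOn : ContinuousOn I (Icc 0 T)
  map_zero : I 0 = 0
  bounds : ∃ K : ℝ,
    (∀ s t : ℝ, 0 ≤ s → s ≤ t → t ≤ T →
      ‖hatDelta S I t s‖ ≤ K * (c₁ + c₂) * (t - s) ^ α) ∧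
    (∀ s t : ℝ, 0 < s → s ≤ t → t ≤ T →
      ‖hatDelta S I t s - Ξ t s‖ ≤ K * c₂ * s ^ (-β) * (t - s) ^ ρ)

/-- The Hölder norm `‖y‖_γ = sup_{0≤t≤T} |y_t| + sup_{0≤s<t≤T} |y_t - y_s| / (t-s)^γ`. -/
def holderNorm {W : Type u} [NormedAddCommGroup W] (T γ : ℝ) (y : ℝ → W) : ℝ≥0∞ :=
  (⨆ (t : ℝ) (_ : t ∈ Icc 0 T), ‖y t‖ₑ) +
  ⨆ (s : ℝ) (t : ℝ) (_ : 0 ≤ s ∧ s < t ∧ t ≤ T),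
    ENNReal.ofReal (‖delta y t s‖ / (t - s) ^ γ)

/-- The weighted Hölder norm
`‖y‖_{γ,γ} = sup_{0≤t≤T} |y_t| + sup_{0<s<t≤T} s^γ |y_t - y_s| / (t-s)^γ`. -/
def weightedHolderNorm {W : Type u} [NormedAddCommGroup W] (T γ : ℝ) (y : ℝ → W) : ℝ≥0∞ :=
  (⨆ (t : ℝ) (_ : t ∈ Icc 0 T), ‖y t‖ₑ) +
  ⨆ (s : ℝ) (t : ℝ) (_ : 0 < s ∧ s < t ∧ t ≤ T),
    ENNReal.ofReal (s ^ γ * (‖delta y t s‖ / (t - s) ^ γ))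

end MildSewing

end

/-!
The path is first constructed away from time `0`. For a fixed final time `t` the functional
`(v, u) ↦ S (t - v) (Ξ v u)` is almost additive in the ordinary sense on `[s, t]`, with a defect of
order `ρ > 1` and a constant proportional to `s ^ (-β)`. The ordinary sewing lemma
(`exists_sewing`) yields increments `R t s`, and the uniqueness that comes with it
(`eq_of_norm_sub_le_rpow`) makes them compatible for different `t`
(`IsApproximationTerm.exists_increments`). On intervals with `t - s ≤ s` the singular weight is
absorbed because `α ≤ ρ - β`, so `R t s` is of order `(t - s) ^ α` there; repeated halving extends
this to all `0 < s ≤ t` (`norm_le_of_near`), and `R t s` converges as `s → 0`. The limit is the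
sewn path (`exists_isSewing_uniform`). Two sewn paths differ by an orbit of the semigroup on
`(0, T]` that tends to `0` at time `0`, hence they agree (`IsSewing.eqOn`).

The regularity estimates use the rescaled semigroup `V t = e^{-ωt} S t`, which is exponentially
stable. Analyticity enters only through the bound `C / t` for the derivative of its orbits
(`IsAnalyticSemigroup.exists_isStableAnalytic`), obtained from the Cauchy estimate. The
substitution `r = t q` in a double integral
(`integral_rpow_smul_integral_rpow_smul`) shows, without any identity for the Gamma function, that
the negative fractional powers are injective, and that `V h x` has a preimage of norm at most
`C h ^ (-ε) ‖x‖` under the power of order `-ε` (`IsStableAnalytic.exists_preimage`). The derivative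
bound also makes orbits that start in `D_ε` Hölder continuous of order `ε` at time `0`.

Writing an increment `hatDelta S I t s` as a telescoping sum over the times `t - 2⁻ᵏ (t - s)` and
applying the smoothing effect to each term gives a series that is geometric for `ε < α`
(`exists_negFracPow_eq_hatDelta`). In particular `I s ∈ D_γ` for `γ < α`, which controls
`S (t - s) (I s) - I s` and so the ordinary increments (`exists_norm_delta_le`) and the Hölder
norms.
-/

open Set Filter Topology MeasureTheory
open scoped ENNReal

noncomputable section

namespace MildSewing

universe u

/-! ### The sewing lemma for additive functionals -/

/-- The constant of the sewing lemma with exponent `ρ > 1`. -/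
def sewingConst (ρ : ℝ) : ℝ := 2 / (1 - 2 ^ (1 - ρ))

lemma two_rpow_one_sub_lt_one {ρ : ℝ} (hρ : 1 < ρ) : (2 : ℝ) ^ (1 - ρ) < 1 :=
  Real.rpow_lt_one_of_one_lt_of_neg (by norm_num) (by linarith)

lemma sewingConst_pos {ρ : ℝ} (hρ : 1 < ρ) : 0 < sewingConst ρ :=
  div_pos two_pos (by linarith [two_rpow_one_sub_lt_one hρ])

lemma sewingConst_eq {ρ : ℝ} (hρ : 1 < ρ) :
    2 + sewingConst ρ * 2 ^ (1 - ρ) = sewingConst ρ := by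
  have h : (1 : ℝ) - 2 ^ (1 - ρ) ≠ 0 := by linarith [two_rpow_one_sub_lt_one hρ]
  unfold sewingConst
  field_simp
  ring

lemma half_rpow {x : ℝ} (hx : 0 ≤ x) (ρ : ℝ) :
    2 * (x / 2) ^ ρ = 2 ^ (1 - ρ) * x ^ ρ := by
  rw [Real.div_rpow hx two_pos.le, Real.rpow_sub two_pos, Real.rpow_one]
  ring

/-- A path with increments of order `ρ > 1` is constant. -/
lemma eq_of_norm_sub_le_rpow {E : Type*} [NormedAddCommGroup E] {D : ℝ → E} {a b K ρ : ℝ}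
    (hρ : 1 < ρ) (hab : a ≤ b)
    (hD : ∀ u v, a ≤ u → u ≤ v → v ≤ b → ‖D v - D u‖ ≤ K * (v - u) ^ ρ) : D b = D a := by
  -- halving the interval improves the constant by the factor `2 ^ (1 - ρ) < 1`
  have key : ∀ n : ℕ, ∀ u v, a ≤ u → u ≤ v → v ≤ b →
      ‖D v - D u‖ ≤ (2 ^ (1 - ρ)) ^ n * (K * (v - u) ^ ρ) := by
    intro n
    induction n with
    | zero => intro u v h1 h2 h3; simpa using hD u v h1 h2 h3
    | succ n ih =>
      intro u v h1 h2 h3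
      have e1 := ih u ((u + v) / 2) h1 (by linarith) (by linarith)
      have e2 := ih ((u + v) / 2) v (by linarith) (by linarith) h3
      rw [show (u + v) / 2 - u = (v - u) / 2 by ring] at e1
      rw [show v - (u + v) / 2 = (v - u) / 2 by ring] at e2
      calc ‖D v - D u‖ ≤ ‖D v - D ((u + v) / 2)‖ + ‖D ((u + v) / 2) - D u‖ :=
            norm_sub_le_norm_sub_add_norm_sub _ _ _
        _ ≤ (2 ^ (1 - ρ)) ^ n * (K * (2 * ((v - u) / 2) ^ ρ)) := by linarith
        _ = _ := by rw [half_rpow (by linarith)]; ring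
  have hlim : Tendsto (fun n : ℕ => ((2 : ℝ) ^ (1 - ρ)) ^ n * (K * (b - a) ^ ρ)) atTop (𝓝 0) := by
    simpa using (tendsto_pow_atTop_nhds_zero_of_lt_one (by positivity)
      (two_rpow_one_sub_lt_one hρ)).mul_const (K * (b - a) ^ ρ)
  have h0 : ‖D b - D a‖ ≤ 0 := ge_of_tendsto' hlim fun n => key n a b le_rfl hab le_rfl
  exact sub_eq_zero.1 (norm_le_zero_iff.1 h0)

section Additive

variable {E : Type*} [NormedAddCommGroup E] {Z : ℝ → ℝ → E} {a b L ρ : ℝ}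

/-- Riemann sums over an arbitrary partition stay close to the two-point value. The partition is
split at the interval that contains the midpoint, so that both remaining pieces have at most half
the length. -/
lemma norm_sum_sub_le_of_defect (hρ : 1 < ρ) (hL : 0 ≤ L)
    (hZ : ∀ u m v, a ≤ u → u ≤ m → m ≤ v → v ≤ b → ‖Z v u - Z v m - Z m u‖ ≤ L * (v - u) ^ ρ)
    {τ : ℕ → ℝ} (hτ : Monotone τ) (hτa : ∀ k, a ≤ τ k) (hτb : ∀ k, τ k ≤ b) (n i : ℕ) :
    ‖∑ k ∈ Finset.range n, Z (τ (i + k + 1)) (τ (i + k)) - Z (τ (i + n)) (τ i)‖ ≤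
      sewingConst ρ * L * (τ (i + n) - τ i) ^ ρ := by
  have hC := sewingConst_pos hρ
  induction n using Nat.strong_induction_on generalizing i with
  | _ n ih =>
    rcases Nat.eq_zero_or_pos n with rfl | hn
    · have h := hZ (τ i) (τ i) (τ i) (hτa i) le_rfl le_rfl (hτb i)
      simpa [Real.zero_rpow (by linarith : ρ ≠ 0)] using h
    have hle : τ i ≤ τ (i + n) := hτ (by omega)
    set μ := (τ i + τ (i + n)) / 2 with hμ
    obtain ⟨k, hkn, hk1, hk2⟩ : ∃ k, k < n ∧ τ (i + k) ≤ μ ∧ μ ≤ τ (i + k + 1) := by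
      have hex : ∃ j, μ ≤ τ (i + j) := ⟨n, by rw [hμ]; linarith⟩
      classical
      have hj := Nat.find_spec hex
      have hjn : Nat.find hex ≤ n := Nat.find_min' hex (by rw [hμ]; linarith)
      rcases Nat.eq_zero_or_pos (Nat.find hex) with h0 | hpos
      · rw [h0] at hj
        exact ⟨0, hn, by rw [hμ]; simp; linarith, hj.trans (hτ (by omega))⟩
      · refine ⟨Nat.find hex - 1, by omega, ?_, ?_⟩
        · exact (not_le.1 (Nat.find_min hex (m := Nat.find hex - 1) (by omega))).le
        · rwa [show i + (Nat.find hex - 1) + 1 = i + Nat.find hex by omega]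
    obtain ⟨r, rfl⟩ : ∃ r, n = k + 1 + r := ⟨n - (k + 1), by omega⟩
    have e1 := ih k (by omega) i
    have e2 := ih r (by omega) (i + k + 1)
    rw [show i + k + 1 + r = i + (k + 1 + r) by ring] at e2
    have m1 : τ i ≤ τ (i + k) := hτ (by omega)
    have m2 : τ (i + k) ≤ τ (i + k + 1) := hτ (by omega)
    have m3 : τ (i + k + 1) ≤ τ (i + (k + 1 + r)) := hτ (by omega)
    have d1 := hZ (τ i) (τ (i + k + 1)) (τ (i + (k + 1 + r))) (hτa _) (m1.trans m2) m3 (hτb _)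
    have d2 := hZ (τ i) (τ (i + k)) (τ (i + k + 1)) (hτa _) m1 m2 (hτb _)
    have hsum : ∑ j ∈ Finset.range (k + 1 + r), Z (τ (i + j + 1)) (τ (i + j)) =
        ∑ j ∈ Finset.range k, Z (τ (i + j + 1)) (τ (i + j)) + Z (τ (i + k + 1)) (τ (i + k)) +
        ∑ j ∈ Finset.range r, Z (τ (i + k + 1 + j + 1)) (τ (i + k + 1 + j)) := by
      rw [Finset.sum_range_add, Finset.sum_range_succ]
      congr 1
      refine Finset.sum_congr rfl fun j _ => ?_
      rw [show i + (k + 1 + j) = i + k + 1 + j by ring]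
    set l := τ (i + (k + 1 + r)) - τ i with hl
    have hl0 : 0 ≤ l := by linarith
    have b1 : (τ (i + k) - τ i) ^ ρ ≤ (l / 2) ^ ρ :=
      Real.rpow_le_rpow (by linarith) (by rw [hl]; linarith) (by linarith)
    have b2 : (τ (i + (k + 1 + r)) - τ (i + k + 1)) ^ ρ ≤ (l / 2) ^ ρ :=
      Real.rpow_le_rpow (by linarith) (by rw [hl]; linarith) (by linarith)
    have b3 : (τ (i + k + 1) - τ i) ^ ρ ≤ l ^ ρ :=
      Real.rpow_le_rpow (by linarith) (by rw [hl]; linarith) (by linarith)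
    rw [hsum]
    set A := ∑ j ∈ Finset.range k, Z (τ (i + j + 1)) (τ (i + j))
    set B := ∑ j ∈ Finset.range r, Z (τ (i + k + 1 + j + 1)) (τ (i + k + 1 + j))
    set Zk := Z (τ (i + k + 1)) (τ (i + k))
    have hsplit : A + Zk + B - Z (τ (i + (k + 1 + r))) (τ i) =
        (A - Z (τ (i + k)) (τ i)) + (B - Z (τ (i + (k + 1 + r))) (τ (i + k + 1))) -
        (Z (τ (i + (k + 1 + r))) (τ i) - Z (τ (i + (k + 1 + r))) (τ (i + k + 1)) -
          Z (τ (i + k + 1)) (τ i)) -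
        (Z (τ (i + k + 1)) (τ i) - Zk - Z (τ (i + k)) (τ i)) := by abel
    rw [hsplit]
    have hCL : 0 ≤ sewingConst ρ * L := by positivity
    calc _ ≤ sewingConst ρ * L * (l / 2) ^ ρ + sewingConst ρ * L * (l / 2) ^ ρ +
            L * l ^ ρ + L * l ^ ρ := by
          refine (norm_sub_le _ _).trans (add_le_add ((norm_sub_le _ _).trans (add_le_add
            ((norm_add_le _ _).trans (add_le_add ?_ ?_)) d1)) ?_)
          · exact e1.trans (mul_le_mul_of_nonneg_left b1 hCL)
          · exact e2.trans (mul_le_mul_of_nonneg_left b2 hCL)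
          · exact d2.trans (mul_le_mul_of_nonneg_left b3 hL)
      _ = sewingConst ρ * L * (2 * (l / 2) ^ ρ) + 2 * (L * l ^ ρ) := by ring
      _ = (2 + sewingConst ρ * 2 ^ (1 - ρ)) * L * l ^ ρ := by rw [half_rpow hl0]; ring
      _ = _ := by rw [sewingConst_eq hρ]

/-- The functional is additive up to its defect when an interval is cut at an arbitrary time `c`,
which need not lie in the interval. -/
lemma norm_sub_cut_le (hρ : 1 < ρ)
    (hZ : ∀ u m v, a ≤ u → u ≤ m → m ≤ v → v ≤ b → ‖Z v u - Z v m - Z m u‖ ≤ L * (v - u) ^ ρ)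
    (c : ℝ) (hc : a ≤ c) (hcb : c ≤ b) {x y : ℝ} (hx : a ≤ x) (hxy : x ≤ y) (hy : y ≤ b) :
    ‖Z y x - Z (max y c) (max x c) - Z (min y c) (min x c)‖ ≤ L * (y - x) ^ ρ := by
  have hzero : ∀ u, a ≤ u → u ≤ b → Z u u = 0 := fun u h1 h2 => by
    simpa [Real.zero_rpow (by linarith : ρ ≠ 0)] using hZ u u u h1 le_rfl le_rfl h2
  have h0 : 0 ≤ L * (y - x) ^ ρ :=
    (norm_nonneg _).trans (hZ x x y hx le_rfl hxy hy)
  rcases le_total c x with h | h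
  · rw [max_eq_left (h.trans hxy), max_eq_left h, min_eq_right (h.trans hxy), min_eq_right h,
      hzero c hc hcb]
    simpa using h0
  rcases le_total y c with h' | h'
  · rw [max_eq_right h', max_eq_right h, min_eq_left h', min_eq_left h, hzero c hc hcb]
    simpa using h0
  · rw [max_eq_left h', max_eq_right h, min_eq_right h', min_eq_left h]
    exact hZ x c y hx h h' hy

end Additive

/-- A bound of order `ρ > 1` on each cell of a partition of mesh `h` sums up to order
`h ^ (ρ - 1)`. -/
lemma sum_rpow_le {τ : ℕ → ℝ} (hτ : Monotone τ) {h ρ : ℝ} (hρ : 1 < ρ) (n : ℕ)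
    (hh : ∀ k, τ (k + 1) - τ k ≤ h) :
    ∑ k ∈ Finset.range n, (τ (k + 1) - τ k) ^ ρ ≤ h ^ (ρ - 1) * (τ n - τ 0) := by
  rw [← Finset.sum_range_sub, Finset.mul_sum]
  refine Finset.sum_le_sum fun k _ => ?_
  have h0 : 0 ≤ τ (k + 1) - τ k := sub_nonneg.2 (hτ (Nat.le_succ k))
  calc (τ (k + 1) - τ k) ^ ρ = (τ (k + 1) - τ k) ^ (ρ - 1) * (τ (k + 1) - τ k) := by
        rw [← Real.rpow_add_one' h0 (by linarith), sub_add_cancel]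
    _ ≤ _ := mul_le_mul_of_nonneg_right (Real.rpow_le_rpow h0 (hh k) (by linarith)) h0

/-- The sewing lemma: an almost additive functional of intervals is approximated by the
increments of a path. -/
theorem exists_sewing {E : Type*} [NormedAddCommGroup E] [CompleteSpace E] {Z : ℝ → ℝ → E}
    {a b L ρ : ℝ} (hab : a ≤ b) (hρ : 1 < ρ) (hL : 0 ≤ L)
    (hZ : ∀ u m v, a ≤ u → u ≤ m → m ≤ v → v ≤ b → ‖Z v u - Z v m - Z m u‖ ≤ L * (v - u) ^ ρ) :
    ∃ f : ℝ → E, ∀ u v, a ≤ u → u ≤ v → v ≤ b →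
      ‖f v - f u - Z v u‖ ≤ sewingConst ρ * L * (v - u) ^ ρ := by
  -- the dyadic grid of level `n`, stopped at time `v`
  set h : ℕ → ℝ := fun n => (b - a) / 2 ^ n with hh
  have hh0 : ∀ n, 0 ≤ h n := fun n => div_nonneg (by linarith) (by positivity)
  set p : ℕ → ℕ → ℝ := fun n k => a + k * h n with hp
  have hpm : ∀ n, Monotone (p n) := fun n i j hij => by
    have : (i : ℝ) * h n ≤ j * h n := by have := hh0 n; gcongr
    simp only [hp]; linarith
  have hpa : ∀ n k, a ≤ p n k := fun n k => by
    have : 0 ≤ (k : ℝ) * h n := mul_nonneg (Nat.cast_nonneg _) (hh0 n)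
    simp only [hp]; linarith
  have hp0 : ∀ n, p n 0 = a := fun n => by simp [hp]
  have hpN : ∀ n, p n (2 ^ n) = b := fun n => by
    simp only [hp, hh]; push_cast; field_simp; ring
  have hpstep : ∀ n k, p n (k + 1) - p n k = h n := fun n k => by
    simp only [hp]; push_cast; ring
  have hpe : ∀ n k, p (n + 1) (2 * k) = p n k := fun n k => by
    simp only [hp, hh]; push_cast; rw [pow_succ]; field_simp
  have hq : Tendsto (fun n => (h n) ^ (ρ - 1)) atTop (𝓝 0) := by
    have h1 : Tendsto h atTop (𝓝 0) := by
      have := (tendsto_pow_atTop_nhds_zero_of_lt_one (r := (1 / 2 : ℝ)) (by norm_num)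
        (by norm_num)).const_mul (b - a)
      simp only [mul_zero] at this
      refine this.congr fun n => ?_
      simp [hh, div_eq_mul_inv]
    have := h1.rpow_const (p := ρ - 1) (Or.inr (by linarith))
    rwa [Real.zero_rpow (by linarith)] at this
  have hmin : ∀ v n, Monotone fun k => min (p n k) v := fun v n i j hij =>
    min_le_min_right v (hpm n hij)
  have hminstep : ∀ v n k, min (p n (k + 1)) v - min (p n k) v ≤ h n := fun v n k => by
    have h1 := hpstep n k
    have h2 := hh0 n
    rcases le_total (p n k) v with h' | h'
    · rw [min_eq_left h']; linarith [min_le_left (p n (k + 1)) v]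
    · rw [min_eq_right h', min_eq_right (h'.trans (hpm n (Nat.le_succ k)))]; linarith
  set F : ℕ → ℝ → E := fun n v =>
    ∑ k ∈ Finset.range (2 ^ n), Z (min (p n (k + 1)) v) (min (p n k) v) with hF
  -- refinement of the grid
  have hstep : ∀ v, a ≤ v → v ≤ b → ∀ n,
      dist (F n v) (F (n + 1) v) ≤ L * (b - a) ^ (ρ - 1) * (b - a) * (2 ^ (1 - ρ)) ^ n := by
    intro v hva hvb n
    have hsplit : F (n + 1) v = ∑ k ∈ Finset.range (2 ^ n),
        (Z (min (p (n + 1) (2 * k + 1)) v) (min (p (n + 1) (2 * k)) v) +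
          Z (min (p (n + 1) (2 * k + 1 + 1)) v) (min (p (n + 1) (2 * k + 1)) v)) := by
      simp only [hF]
      rw [pow_succ, mul_comm]
      generalize 2 ^ n = N
      induction N with
      | zero => simp
      | succ N ih =>
        rw [show 2 * (N + 1) = 2 * N + 1 + 1 by ring, Finset.sum_range_succ, Finset.sum_range_succ,
          Finset.sum_range_succ, ih]
        abel
    rw [dist_eq_norm, hsplit]
    simp only [hF]
    rw [← Finset.sum_sub_distrib]
    calc _ ≤ ∑ k ∈ Finset.range (2 ^ n), L * (min (p n (k + 1)) v - min (p n k) v) ^ ρ := by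
          refine norm_sum_le_of_le _ fun k _ => ?_
          have e2 : p (n + 1) (2 * k + 1 + 1) = p n (k + 1) := hpe n (k + 1)
          rw [hpe, e2]
          have := hZ (min (p n k) v) (min (p (n + 1) (2 * k + 1)) v) (min (p n (k + 1)) v)
            (le_min (hpa _ _) hva)
            (by rw [← hpe]; exact hmin v (n + 1) (Nat.le_succ _))
            (by rw [← e2]; exact hmin v (n + 1) (Nat.le_succ _))
            ((min_le_right _ _).trans hvb)
          refine le_of_eq_of_le ?_ this
          congr 1; abel
      _ ≤ L * (h n ^ (ρ - 1) * (min (p n (2 ^ n)) v - min (p n 0) v)) := by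
          rw [← Finset.mul_sum]
          exact mul_le_mul_of_nonneg_left
            (sum_rpow_le (hmin v n) hρ (2 ^ n) (hminstep v n)) hL
      _ ≤ L * (h n ^ (ρ - 1) * (b - a)) := by
          rw [hpN, hp0, min_eq_right hvb, min_eq_left hva]
          have := Real.rpow_nonneg (hh0 n) (ρ - 1)
          gcongr
      _ = _ := by
          simp only [hh]
          rw [Real.div_rpow (by linarith) (by positivity), ← Real.rpow_natCast, ← Real.rpow_mul
            two_pos.le, ← Real.rpow_natCast, ← Real.rpow_mul two_pos.le,
            show (1 - ρ) * n = -(n * (ρ - 1)) by ring, Real.rpow_neg two_pos.le]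
          ring
  have hlim : ∀ v, ∃ x, a ≤ v → v ≤ b → Tendsto (fun n => F n v) atTop (𝓝 x) := by
    intro v
    by_cases hv : a ≤ v ∧ v ≤ b
    · obtain ⟨x, hx⟩ := cauchySeq_tendsto_of_complete
        (cauchySeq_of_le_geometric _ _ (two_rpow_one_sub_lt_one hρ) (hstep v hv.1 hv.2))
      exact ⟨x, fun _ _ => hx⟩
    · exact ⟨0, fun h1 h2 => absurd ⟨h1, h2⟩ hv⟩
  choose f hf using hlim
  refine ⟨f, fun u v hu huv hv => ?_⟩
  have hlim2 : Tendsto (fun n => L * (h n ^ (ρ - 1) * (v - a)) +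
      sewingConst ρ * L * (v - u) ^ ρ) atTop (𝓝 (sewingConst ρ * L * (v - u) ^ ρ)) := by
    simpa using ((hq.mul_const (v - a)).const_mul L).add_const (sewingConst ρ * L * (v - u) ^ ρ)
  refine le_of_tendsto_of_tendsto' (((hf v (hu.trans huv) hv).sub
    (hf u hu (huv.trans hv))).sub_const (Z v u)).norm hlim2 fun n => ?_
  -- the grid points in `[u, v]`
  set τ : ℕ → ℝ := fun k => max (min (p n k) v) u with hτ
  have hτm : Monotone τ := fun i j hij => max_le_max_right u (hmin v n hij)
  have hmax := norm_sum_sub_le_of_defect hρ hL hZ hτm (fun k => hu.trans (le_max_right _ _))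
    (fun k => max_le ((min_le_right _ _).trans hv) (huv.trans hv)) (2 ^ n) 0
  simp only [zero_add] at hmax
  have t0 : τ 0 = u := by simp [hτ, hp0, hu]
  have tN : τ (2 ^ n) = v := by
    simp only [hτ]; rw [hpN, min_eq_right hv, max_eq_left huv]
  rw [t0, tN] at hmax
  have hcut : ‖F n v - ∑ k ∈ Finset.range (2 ^ n), Z (τ (k + 1)) (τ k) - F n u‖ ≤
      L * (h n ^ (ρ - 1) * (v - a)) := by
    simp only [hF]
    rw [← Finset.sum_sub_distrib, ← Finset.sum_sub_distrib]
    calc _ ≤ ∑ k ∈ Finset.range (2 ^ n), L * (min (p n (k + 1)) v - min (p n k) v) ^ ρ := by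
          refine norm_sum_le_of_le _ fun k _ => ?_
          have := norm_sub_cut_le hρ hZ u hu (huv.trans hv) (le_min (hpa n k) (hu.trans huv))
            (hmin v n (Nat.le_succ k)) ((min_le_right _ _).trans hv)
          rwa [min_assoc, min_assoc, min_eq_right huv] at this
      _ ≤ L * (h n ^ (ρ - 1) * (min (p n (2 ^ n)) v - min (p n 0) v)) := by
          rw [← Finset.mul_sum]
          exact mul_le_mul_of_nonneg_left
            (sum_rpow_le (hmin v n) hρ (2 ^ n) (hminstep v n)) hL
      _ = _ := by rw [hpN, hp0, min_eq_right hv, min_eq_left (hu.trans huv)]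
  calc ‖F n v - F n u - Z v u‖ =
      ‖(F n v - ∑ k ∈ Finset.range (2 ^ n), Z (τ (k + 1)) (τ k) - F n u) +
        (∑ k ∈ Finset.range (2 ^ n), Z (τ (k + 1)) (τ k) - Z v u)‖ := by congr 1; abel
    _ ≤ _ := (norm_add_le _ _).trans (add_le_add hcut hmax)

/-! ### Strongly continuous semigroups -/

section Semigroup

variable {W : Type u} [NormedAddCommGroup W] [NormedSpace ℝ W] {S : ℝ → W →L[ℝ] W}

lemma GrowthBoundLT.exists_bound {ω : ℝ} (hω : GrowthBoundLT S ω) (T : ℝ) :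
    ∃ M : ℝ, 1 ≤ M ∧ ∀ t, 0 ≤ t → t ≤ T → ‖S t‖ ≤ M := by
  obtain ⟨M, ω', -, h⟩ := hω
  refine ⟨max 1 (|M| * Real.exp (|ω'| * T)), le_max_left _ _, fun t h0 hT => ?_⟩
  refine (h t h0).trans (le_trans ?_ (le_max_right _ _))
  have h1 : ω' * t ≤ |ω'| * T :=
    (mul_le_mul_of_nonneg_right (le_abs_self ω') h0).trans
      (mul_le_mul_of_nonneg_left hT (abs_nonneg _))
  exact mul_le_mul (le_abs_self M) (Real.exp_le_exp.2 h1) (Real.exp_pos _).le (abs_nonneg _)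

lemma IsC0Semigroup.apply_apply (hS : IsC0Semigroup S) {s t : ℝ} (hs : 0 ≤ s) (ht : 0 ≤ t)
    (x : W) : S s (S t x) = S (s + t) x := by
  rw [hS.map_add s t hs ht]; rfl

lemma IsC0Semigroup.zero_apply (hS : IsC0Semigroup S) (x : W) : S 0 x = x := by
  rw [hS.map_zero]; rfl

lemma IsC0Semigroup.norm_sub_le (hS : IsC0Semigroup S) {T M : ℝ}
    (hM : ∀ t, 0 ≤ t → t ≤ T → ‖S t‖ ≤ M) (x : W) {s t : ℝ} (hs : 0 ≤ s) (hsT : s ≤ T)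
    (ht : 0 ≤ t) (htT : t ≤ T) : ‖S t x - S s x‖ ≤ M * ‖S |t - s| x - x‖ := by
  wlog h : s ≤ t generalizing s t
  · rw [norm_sub_rev, abs_sub_comm]
    exact this ht htT hs hsT (le_of_not_ge h)
  rw [abs_of_nonneg (sub_nonneg.2 h)]
  have : S t x - S s x = S s (S (t - s) x - x) := by
    rw [map_sub, hS.apply_apply hs (sub_nonneg.2 h), add_sub_cancel]
  rw [this]
  exact (S s).le_of_opNorm_le (hM s hs hsT) _

lemma IsC0Semigroup.continuousOn (hS : IsC0Semigroup S) {ω : ℝ} (hω : GrowthBoundLT S ω) (x : W) :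
    ContinuousOn (fun t => S t x) (Ici 0) := by
  intro s hs
  obtain ⟨M, -, hM⟩ := hω.exists_bound (s + 1)
  have h0 : Tendsto (fun t => S t x) (𝓝[≥] 0) (𝓝 x) := by
    rw [← Ioi_insert, nhdsWithin_insert, tendsto_sup]
    refine ⟨?_, hS.tendsto_zero x⟩
    rw [tendsto_pure_left]
    intro s hs
    rw [hS.zero_apply]
    exact mem_of_mem_nhds hs
  have h1 : Tendsto (fun t => |t - s|) (𝓝[Ici 0] s) (𝓝[≥] 0) := by
    refine tendsto_nhdsWithin_iff.2 ⟨?_, Eventually.of_forall fun t => mem_Ici.2 (abs_nonneg _)⟩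
    have : Tendsto (fun t => |t - s|) (𝓝 s) (𝓝 |s - s|) :=
      (continuous_abs.comp (continuous_id.sub continuous_const)).tendsto s
    rw [sub_self, abs_zero] at this
    exact this.mono_left nhdsWithin_le_nhds
  have h2 : Tendsto (fun t => M * ‖S |t - s| x - x‖) (𝓝[Ici 0] s) (𝓝 0) := by
    have := (((h0.comp h1).sub_const x).norm).const_mul M
    simpa using this
  refine tendsto_iff_norm_sub_tendsto_zero.2 (squeeze_zero' (Eventually.of_forall fun _ =>
    norm_nonneg _) ?_ h2)
  have hnear : ∀ᶠ t in 𝓝[Ici 0] s, t < s + 1 :=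
    nhdsWithin_le_nhds (Iio_mem_nhds (by linarith))
  filter_upwards [hnear, self_mem_nhdsWithin] with t ht ht0
  exact hS.norm_sub_le hM x hs (by linarith) ht0 ht.le

end Semigroup

/-! ### The sewing lemma for semigroups -/

section Sewing

variable {W : Type u} [NormedAddCommGroup W] [NormedSpace ℝ W] {S : ℝ → W →L[ℝ] W}
  {T α β ρ c₁ c₂ M : ℝ} {Ξ : ℝ → ℝ → W}

lemma IsApproximationTerm.c₁_nonneg (h : IsApproximationTerm S T α β ρ c₁ c₂ Ξ) (hT : 0 < T) :
    0 ≤ c₁ := by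
  have := (norm_nonneg _).trans (h.bound 0 T le_rfl hT.le le_rfl)
  have h2 : 0 < (T - 0) ^ α := Real.rpow_pos_of_pos (by linarith) _
  exact nonneg_of_mul_nonneg_left this h2

lemma IsApproximationTerm.c₂_nonneg (h : IsApproximationTerm S T α β ρ c₁ c₂ Ξ) (hT : 0 < T) :
    0 ≤ c₂ := by
  have := (norm_nonneg _).trans
    (h.hatDelta₂_bound (T / 2) (T / 2) T (by linarith) le_rfl (by linarith) le_rfl)
  have h2 : 0 < (T - T / 2) ^ ρ := Real.rpow_pos_of_pos (by linarith) _
  have h3 : 0 < (T / 2) ^ (-β) := Real.rpow_pos_of_pos (by linarith) _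
  exact nonneg_of_mul_nonneg_left (nonneg_of_mul_nonneg_left this h2) h3

/-- The sewn increments away from time `0`. For a fixed final time `t` the functional
`S (t - v) (Ξ v u)` is almost additive in the ordinary sense; uniqueness in the ordinary sewing
lemma makes the resulting increments compatible for different `t`. -/
lemma IsApproximationTerm.exists_increments [CompleteSpace W]
    (h : IsApproximationTerm S T α β ρ c₁ c₂ Ξ) (hS : IsC0Semigroup S) (hρ : 1 < ρ) (hβ : 0 ≤ β)
    (hT : 0 < T) (hM0 : 0 ≤ M) (hM : ∀ t, 0 ≤ t → t ≤ T → ‖S t‖ ≤ M) :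
    ∃ R : ℝ → ℝ → W,
      (∀ s t, 0 < s → s ≤ t → t ≤ T →
        ‖R t s - Ξ t s‖ ≤ sewingConst ρ * M * c₂ * s ^ (-β) * (t - s) ^ ρ) ∧
      (∀ s m t, 0 < s → s ≤ m → m ≤ t → t ≤ T → R t s = R t m + S (t - m) (R m s)) := by
  have hc₂ := h.c₂_nonneg hT
  have hf : ∀ t s, ∃ f : ℝ → W, 0 < s → s ≤ t → t ≤ T → ∀ u v, s ≤ u → u ≤ v → v ≤ t →
      ‖f v - f u - S (t - v) (Ξ v u)‖ ≤
        sewingConst ρ * (M * (c₂ * s ^ (-β))) * (v - u) ^ ρ := by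
    intro t s
    by_cases hst : 0 < s ∧ s ≤ t ∧ t ≤ T
    · obtain ⟨hs, hst, htT⟩ := hst
      obtain ⟨f, hf⟩ := exists_sewing (Z := fun v u => S (t - v) (Ξ v u)) hst hρ
        (L := M * (c₂ * s ^ (-β))) (by positivity) (by
          intro u m v hu hum hmv hv
          have e : S (t - v) (Ξ v u) - S (t - v) (Ξ v m) - S (t - m) (Ξ m u) =
              S (t - v) (hatDelta₂ S Ξ v m u) := by
            unfold hatDelta₂
            rw [map_sub, map_sub, hS.apply_apply (by linarith) (by linarith),
              show t - v + (v - m) = t - m by ring]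
          rw [e]
          calc ‖S (t - v) (hatDelta₂ S Ξ v m u)‖ ≤ M * ‖hatDelta₂ S Ξ v m u‖ :=
                (S (t - v)).le_of_opNorm_le (hM _ (by linarith) (by linarith)) _
            _ ≤ M * (c₂ * u ^ (-β) * (v - u) ^ ρ) := by
                gcongr
                exact h.hatDelta₂_bound u m v (by linarith) hum hmv (by linarith)
            _ ≤ M * (c₂ * s ^ (-β) * (v - u) ^ ρ) := by
                have h1 : u ^ (-β) ≤ s ^ (-β) :=
                  Real.rpow_le_rpow_of_nonpos hs hu (by linarith)
                have h2 : 0 ≤ (v - u) ^ ρ := Real.rpow_nonneg (by linarith) _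
                gcongr
            _ = _ := by ring)
      exact ⟨f, fun _ _ _ => hf⟩
    · exact ⟨0, fun h1 h2 h3 => absurd ⟨h1, h2, h3⟩ hst⟩
  choose f hf using hf
  refine ⟨fun t s => f t s t - f t s s, fun s t hs hst htT => ?_, fun s m t hs hsm hmt htT => ?_⟩
  · have := hf t s hs hst htT s t le_rfl hst le_rfl
    rw [sub_self, hS.zero_apply] at this
    refine this.trans (le_of_eq (by ring))
  · have hm : 0 < m := hs.trans_le hsm
    have hst := hsm.trans hmt
    have d1 := eq_of_norm_sub_le_rpow (D := fun v => f t s v - f t m v) (a := m) (b := t)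
      (K := sewingConst ρ * (M * (c₂ * s ^ (-β))) + sewingConst ρ * (M * (c₂ * m ^ (-β)))) hρ hmt
      (fun u v hu huv hv => by
        have e1 := hf t s hs hst htT u v (hsm.trans hu) huv hv
        have e2 := hf t m hm hmt htT u v hu huv hv
        rw [add_mul]
        refine le_trans (le_of_eq ?_) ((norm_sub_le _ _).trans (add_le_add e1 e2))
        congr 1; abel)
    have d2 := eq_of_norm_sub_le_rpow (D := fun v => f t s v - S (t - m) (f m s v))
      (a := s) (b := m)
      (K := sewingConst ρ * (M * (c₂ * s ^ (-β))) + M * (sewingConst ρ * (M * (c₂ * s ^ (-β)))))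
      hρ hsm
      (fun u v hu huv hv => by
        have e1 := hf t s hs hst htT u v hu huv (hv.trans hmt)
        have e2 := hf m s hs hsm (hmt.trans htT) u v hu huv hv
        have e3 := (S (t - m)).le_of_opNorm_le (hM _ (by linarith) (by linarith))
          (f m s v - f m s u - S (m - v) (Ξ v u))
        rw [map_sub, map_sub, hS.apply_apply (by linarith) (by linarith),
          show t - m + (m - v) = t - v by ring] at e3
        have e4 := e3.trans (mul_le_mul_of_nonneg_left e2 hM0)
        rw [add_mul, mul_assoc M]
        refine le_trans (le_of_eq ?_) ((norm_sub_le _ _).trans (add_le_add e1 e4))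
        congr 1; abel)
    simp only at d1 d2 ⊢
    rw [map_sub]
    calc f t s t - f t s s = (f t s t - f t m t) + f t m t - f t s s := by abel
      _ = f t s m - f t m m + f t m t - f t s s := by rw [d1]
      _ = (f t m t - f t m m) +
          ((f t s m - S (t - m) (f m s m)) + S (t - m) (f m s m) - f t s s) := by abel
      _ = _ := by rw [d2]; abel

/-- Bounds of order `α` that hold on the intervals `[s, t]` with `t - s ≤ s` extend to all
intervals away from `0`: the interval is halved repeatedly, keeping the left half. -/
lemma norm_le_of_near (hS : IsC0Semigroup S) (hα : 0 < α) {R : ℝ → ℝ → W} {K : ℝ} (hK : 0 ≤ K)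
    (hM0 : 0 ≤ M) (hM : ∀ t, 0 ≤ t → t ≤ T → ‖S t‖ ≤ M)
    (hR : ∀ s m t, 0 < s → s ≤ m → m ≤ t → t ≤ T → R t s = R t m + S (t - m) (R m s))
    (hnear : ∀ s t, 0 < s → s ≤ t → t ≤ T → t - s ≤ s → ‖R t s‖ ≤ K * (t - s) ^ α)
    {s t : ℝ} (hs : 0 < s) (hst : s ≤ t) (htT : t ≤ T) :
    ‖R t s‖ ≤ M * K * (1 - 2 ^ (-α))⁻¹ * (t - s) ^ α := by
  set C : ℝ := (1 - 2 ^ (-α))⁻¹ with hC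
  have h2 : (2 : ℝ) ^ (-α) < 1 := Real.rpow_lt_one_of_one_lt_of_neg (by norm_num) (by linarith)
  have h2' : (0 : ℝ) < 2 ^ (-α) := by positivity
  have hC0 : 0 < C := inv_pos.2 (by linarith)
  have hCeq : C * (1 - 2 ^ (-α)) = 1 := inv_mul_cancel₀ (by linarith)
  have hC1 : 1 ≤ C := by nlinarith
  have key : ∀ n : ℕ, ∀ s t a, 0 < s → s ≤ t → 0 ≤ a → a + t ≤ T → t - s ≤ 2 ^ n * s →
      ‖S a (R t s)‖ ≤ M * K * C * (t - s) ^ α := by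
    intro n
    induction n with
    | zero =>
      intro s t a hs hst ha hat hn
      have h1 := hnear s t hs hst (by linarith) (by simpa using hn)
      have h3 := (S a).le_of_opNorm_le (hM a ha (by linarith)) (R t s)
      have h4 : 0 ≤ (t - s) ^ α := Real.rpow_nonneg (by linarith) _
      calc _ ≤ M * (K * (t - s) ^ α) := h3.trans (mul_le_mul_of_nonneg_left h1 hM0)
        _ = M * K * 1 * (t - s) ^ α := by ring
        _ ≤ _ := by gcongr
    | succ n ih =>
      intro s t a hs hst ha hat hn
      set m := (s + t) / 2 with hm
      have hsm : s ≤ m := by rw [hm]; linarith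
      have hmt : m ≤ t := by rw [hm]; linarith
      have e1 : t - m = (t - s) / 2 := by rw [hm]; ring
      have e2 : m - s = (t - s) / 2 := by rw [hm]; ring
      have h1 := hnear m t (by linarith) hmt (by linarith) (by rw [e1, hm]; linarith)
      have h3 := ((S a).le_of_opNorm_le (hM a ha (by linarith)) (R t m)).trans
        (mul_le_mul_of_nonneg_left h1 hM0)
      have h4 := ih s m (a + (t - m)) hs hsm (by linarith) (by linarith)
        (by rw [e2]; rw [pow_succ] at hn; linarith)
      rw [hR s m t hs hsm hmt (by linarith), map_add, hS.apply_apply ha (by linarith)]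
      rw [e1] at h3
      rw [e2] at h4
      have h5 : ((t - s) / 2) ^ α = 2 ^ (-α) * (t - s) ^ α := by
        rw [Real.div_rpow (by linarith) two_pos.le, Real.rpow_neg two_pos.le]; ring
      rw [h5] at h3 h4
      have h6 : 0 ≤ M * K * (t - s) ^ α :=
        mul_nonneg (mul_nonneg hM0 hK) (Real.rpow_nonneg (by linarith) _)
      calc _ ≤ M * (K * (2 ^ (-α) * (t - s) ^ α)) + M * K * C * (2 ^ (-α) * (t - s) ^ α) :=
            (norm_add_le _ _).trans (add_le_add h3 (by rw [hm] at h4 ⊢; exact h4))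
        _ = (M * K * (t - s) ^ α) * (2 ^ (-α) + C * 2 ^ (-α)) := by ring
        _ ≤ (M * K * (t - s) ^ α) * C := by gcongr; nlinarith
        _ = _ := by ring
  obtain ⟨n, hn⟩ := pow_unbounded_of_one_lt ((t - s) / s) (one_lt_two : (1 : ℝ) < 2)
  have := key n s t 0 hs hst le_rfl (by linarith) ((div_lt_iff₀ hs).1 hn).le
  rwa [hS.zero_apply] at this

/-- Additive increments of order `α` away from time `0` are the increments `hatDelta` of a path
that starts at `0`. -/
lemma exists_path_of_increments [CompleteSpace W] (hα : 0 < α)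
    {R : ℝ → ℝ → W} {K : ℝ} (hM0 : 0 ≤ M) (hM : ∀ t, 0 ≤ t → t ≤ T → ‖S t‖ ≤ M)
    (hR : ∀ s m t, 0 < s → s ≤ m → m ≤ t → t ≤ T → R t s = R t m + S (t - m) (R m s))
    (hRb : ∀ s t, 0 < s → s ≤ t → t ≤ T → ‖R t s‖ ≤ K * (t - s) ^ α) :
    ∃ I : ℝ → W, I 0 = 0 ∧ (∀ s t, 0 < s → s ≤ t → t ≤ T → hatDelta S I t s = R t s) ∧
      ∀ s t, 0 ≤ s → s ≤ t → t ≤ T → ‖hatDelta S I t s‖ ≤ K * (t - s) ^ α := by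
  have hpow : Tendsto (fun s : ℝ => M * (K * s ^ α)) (𝓝[>] 0) (𝓝 0) := by
    have h1 : Tendsto (fun s : ℝ => s ^ α) (𝓝[>] 0) (𝓝 0) := by
      have := (Real.continuousAt_rpow_const 0 α (Or.inr hα.le)).tendsto
      rw [Real.zero_rpow hα.ne'] at this
      exact this.mono_left nhdsWithin_le_nhds
    simpa using (h1.const_mul K).const_mul M
  have hlim : ∀ t, ∃ x, 0 < t → t ≤ T → Tendsto (fun s => R t s) (𝓝[>] 0) (𝓝 x) := by
    intro t
    by_cases ht : 0 < t ∧ t ≤ T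
    · obtain ⟨ht0, htT⟩ := ht
      have hK : 0 ≤ K := by
        have := (norm_nonneg _).trans (hRb (t / 2) t (by linarith) (by linarith) htT)
        exact nonneg_of_mul_nonneg_left this (Real.rpow_pos_of_pos (by linarith) _)
      have hdiff : ∀ s s', 0 < s' → s' ≤ s → s ≤ t → ‖R t s' - R t s‖ ≤ M * (K * s ^ α) := by
        intro s s' hs' hss hst
        rw [hR s' s t hs' hss hst htT, add_sub_cancel_left]
        refine ((S (t - s)).le_of_opNorm_le (hM _ (by linarith) (by linarith)) _).trans ?_
        refine mul_le_mul_of_nonneg_left ((hRb s' s hs' hss (by linarith)).trans ?_) hM0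
        exact mul_le_mul_of_nonneg_left
          (Real.rpow_le_rpow (by linarith) (by linarith) hα.le) hK
      have hc : Cauchy (map (fun s => R t s) (𝓝[>] 0)) := by
        refine Metric.cauchy_iff.2 ⟨inferInstance, fun δ hδ => ?_⟩
        obtain ⟨s, hs, hs0, hst⟩ := ((hpow.eventually (gt_mem_nhds (half_pos hδ))).and
          (Ioc_mem_nhdsGT ht0)).exists
        refine ⟨(fun r => R t r) '' Ioc 0 s, image_mem_map (Ioc_mem_nhdsGT hs0), ?_⟩
        rintro _ ⟨r, hr, rfl⟩ _ ⟨r', hr', rfl⟩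
        have h1 := hdiff s r hr.1 hr.2 hst
        have h2 := hdiff s r' hr'.1 hr'.2 hst
        calc dist (R t r) (R t r') ≤ dist (R t r) (R t s) + dist (R t r') (R t s) :=
              dist_triangle_right _ _ _
          _ < δ := by rw [dist_eq_norm, dist_eq_norm]; linarith
      obtain ⟨x, hx⟩ := CompleteSpace.complete hc
      exact ⟨x, fun _ _ => hx⟩
    · exact ⟨0, fun h1 h2 => absurd ⟨h1, h2⟩ ht⟩
  choose I hI using hlim
  have hI0 : ∀ t, 0 < t → (if t = 0 then (0 : W) else I t) = I t := fun t ht => if_neg ht.ne'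
  have hRI : ∀ s t, 0 < s → s ≤ t → t ≤ T → I t - S (t - s) (I s) = R t s := by
    intro s t hs hst htT
    have h1 := (hI t (hs.trans_le hst) htT).sub
      (((S (t - s)).continuous.tendsto _).comp (hI s hs (hst.trans htT)))
    refine tendsto_nhds_unique (h1.congr' ?_) tendsto_const_nhds
    filter_upwards [Ioc_mem_nhdsGT hs] with r hr
    rw [hR r s t hr.1 hr.2 hst htT]
    simp
  refine ⟨fun t => if t = 0 then 0 else I t, if_pos rfl, fun s t hs hst htT => ?_,
    fun s t hs hst htT => ?_⟩
  · simp only [hatDelta]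
    rw [hI0 s hs, hI0 t (hs.trans_le hst)]
    exact hRI s t hs hst htT
  · simp only [hatDelta]
    rcases hs.eq_or_lt with rfl | hs
    · simp only [if_true, map_zero, sub_zero]
      split_ifs with h0
      · rw [h0, Real.zero_rpow hα.ne']; simp
      · have ht : 0 < t := lt_of_le_of_ne hst (Ne.symm h0)
        have h2 : Tendsto (fun s => K * (t - s) ^ α) (𝓝[>] 0) (𝓝 (K * (t - 0) ^ α)) := by
          have : ContinuousAt (fun s => K * (t - s) ^ α) 0 := by
            refine ContinuousAt.const_mul ?_ _
            exact (continuousAt_const.sub continuousAt_id).rpow_const (Or.inr hα.le)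
          exact this.tendsto.mono_left nhdsWithin_le_nhds
        rw [sub_zero] at h2
        refine le_of_tendsto_of_tendsto (hI t ht htT).norm h2 ?_
        filter_upwards [Ioc_mem_nhdsGT ht] with r hr
        exact hRb r t hr.1 hr.2 htT
    · rw [hI0 s hs, hI0 t (hs.trans_le hst), hRI s t hs hst htT]
      exact hRb s t hs hst htT

/-- A path whose increments `hatDelta` are of positive order is continuous. -/
lemma continuousOn_of_hatDelta_le (hS : IsC0Semigroup S) {ω : ℝ} (hω : GrowthBoundLT S ω)
    (hα : 0 < α) {I : ℝ → W} {K : ℝ}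
    (hI : ∀ s t, 0 ≤ s → s ≤ t → t ≤ T → ‖hatDelta S I t s‖ ≤ K * (t - s) ^ α) :
    ContinuousOn I (Icc 0 T) := by
  intro t ht
  have hr : ∀ δ > 0, ∃ r, 0 ≤ r ∧ r ≤ t ∧ K * (t - r) ^ α < δ ∧
      ∀ᶠ s in 𝓝[Icc 0 T] t, r ≤ s := by
    intro δ hδ
    rcases ht.1.eq_or_lt with h0 | h0
    · refine ⟨0, le_rfl, ht.1, ?_, ?_⟩
      · rw [← h0]; simpa [Real.zero_rpow hα.ne'] using hδ
      · filter_upwards [self_mem_nhdsWithin] with s hs using hs.1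
    · have h1 : Tendsto (fun r : ℝ => K * (t - r) ^ α) (𝓝[<] t) (𝓝 0) := by
        have : ContinuousAt (fun s => K * (t - s) ^ α) t := by
          refine ContinuousAt.const_mul ?_ _
          exact (continuousAt_const.sub continuousAt_id).rpow_const (Or.inr hα.le)
        have h := this.tendsto.mono_left (nhdsWithin_le_nhds (s := Iio t))
        simpa [Real.zero_rpow hα.ne'] using h
      obtain ⟨r, hr1, hr2⟩ := ((h1.eventually (gt_mem_nhds hδ)).and
        (Ico_mem_nhdsLT h0)).exists
      exact ⟨r, hr2.1, hr2.2.le, hr1, nhdsWithin_le_nhds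
        (mem_of_superset (Ioi_mem_nhds hr2.2) fun s hs => (mem_Ioi.1 hs).le)⟩
  refine Metric.tendsto_nhds.2 fun δ hδ => ?_
  -- comparison with the orbit that starts from `I r` at an earlier time `r`
  obtain ⟨r, hr0, hrt, hrδ, hrs⟩ := hr (δ / 3) (by linarith)
  have horb : Tendsto (fun s => S (s - r) (I r)) (𝓝[Icc 0 T ∩ Ici r] t)
      (𝓝 (S (t - r) (I r))) := by
    have h1 := hS.continuousOn hω (I r) (t - r) (by simpa using hrt)
    refine h1.tendsto.comp (tendsto_nhdsWithin_iff.2 ⟨?_, ?_⟩)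
    · exact ((continuous_id.sub continuous_const).tendsto t).mono_left nhdsWithin_le_nhds
    · filter_upwards [self_mem_nhdsWithin] with s hs
      simpa using hs.2
  have hsmall : ∀ᶠ s in 𝓝[Icc 0 T] t, K * (s - r) ^ α < δ / 3 := by
    have : ContinuousAt (fun s => K * (s - r) ^ α) t := by
      refine ContinuousAt.const_mul ?_ _
      exact (continuousAt_id.sub continuousAt_const).rpow_const (Or.inr hα.le)
    exact nhdsWithin_le_nhds (this.tendsto.eventually (gt_mem_nhds hrδ))
  have hset : 𝓝[Icc 0 T ∩ Ici r] t = 𝓝[Icc 0 T] t := by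
    rw [nhdsWithin_inter', inf_eq_left.2]
    exact le_principal_iff.2 hrs
  rw [hset] at horb
  filter_upwards [hsmall, hrs, self_mem_nhdsWithin,
    Metric.tendsto_nhds.1 horb (δ / 3) (by linarith)] with s h1 h2 h3 h4
  have e1 := hI r s hr0 h2 h3.2
  have e2 := hI r t hr0 hrt ht.2
  rw [hatDelta, ← dist_eq_norm] at e1 e2
  calc dist (I s) (I t) ≤ dist (I s) (S (s - r) (I r)) +
        dist (S (s - r) (I r)) (S (t - r) (I r)) + dist (S (t - r) (I r)) (I t) :=
        dist_triangle4 _ _ _ _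
    _ < δ := by rw [dist_comm _ (I t)]; linarith

/-- Existence in the sewing lemma for semigroups, with a constant that is uniform for bounded
time horizons. -/
theorem exists_isSewing_uniform [CompleteSpace W] (hS : IsC0Semigroup S) {ω : ℝ}
    (hω : GrowthBoundLT S ω) (hα : 0 < α) (hβ : 0 ≤ β) (hρ : 1 < ρ) (hαβρ : α + β ≤ ρ) (T₀ : ℝ) :
    ∃ K : ℝ, 0 ≤ K ∧ ∀ (T c₁ c₂ : ℝ) (Ξ : ℝ → ℝ → W), 0 < T → T ≤ T₀ →
      IsApproximationTerm S T α β ρ c₁ c₂ Ξ → ∃ I : ℝ → W, ContinuousOn I (Icc 0 T) ∧ I 0 = 0 ∧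
        (∀ s t : ℝ, 0 ≤ s → s ≤ t → t ≤ T →
          ‖hatDelta S I t s‖ ≤ K * (c₁ + c₂) * (t - s) ^ α) ∧
        (∀ s t : ℝ, 0 < s → s ≤ t → t ≤ T →
          ‖hatDelta S I t s - Ξ t s‖ ≤ K * c₂ * s ^ (-β) * (t - s) ^ ρ) := by
  obtain ⟨M, hM1, hM⟩ := hω.exists_bound T₀
  rcases le_or_gt T₀ 0 with hT₀ | hT₀
  · exact ⟨0, le_rfl, fun T c₁ c₂ Ξ h1 h2 => absurd (h1.trans_le h2) (not_lt.2 hT₀)⟩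
  have hM0 : 0 ≤ M := by linarith
  have hsC := sewingConst_pos hρ
  set K₀ : ℝ := 1 + sewingConst ρ * M * T₀ ^ (ρ - β - α) with hK₀
  have hK₀' : 0 ≤ K₀ := by positivity
  have hCα : 0 < (1 - (2 : ℝ) ^ (-α))⁻¹ := inv_pos.2 (by
    linarith [Real.rpow_lt_one_of_one_lt_of_neg (one_lt_two : (1 : ℝ) < 2)
      (by linarith : -α < 0)])
  set K₁ : ℝ := M * K₀ * (1 - 2 ^ (-α))⁻¹ with hK₁
  have hK₁' : 0 ≤ K₁ := by positivity
  refine ⟨sewingConst ρ * M + K₁, by positivity, fun T c₁ c₂ Ξ hT hTT₀ h => ?_⟩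
  have hc₁ := h.c₁_nonneg hT
  have hc₂ := h.c₂_nonneg hT
  have hM' : ∀ t, 0 ≤ t → t ≤ T → ‖S t‖ ≤ M := fun t h0 h1 => hM t h0 (h1.trans hTT₀)
  obtain ⟨R, hRΞ, hR⟩ := h.exists_increments hS hρ hβ hT hM0 hM'
  have hnear : ∀ s t, 0 < s → s ≤ t → t ≤ T → t - s ≤ s →
      ‖R t s‖ ≤ (K₀ * (c₁ + c₂)) * (t - s) ^ α := by
    intro s t hs hst htT hts
    have e1 := hRΞ s t hs hst htT
    have e2 := h.bound s t hs.le hst htT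
    have hnn : 0 ≤ (t - s) ^ α := Real.rpow_nonneg (by linarith) _
    -- the singular weight is absorbed by the surplus `ρ - β ≥ α` of the exponent
    have e3 : s ^ (-β) * (t - s) ^ ρ ≤ T₀ ^ (ρ - β - α) * (t - s) ^ α := by
      rcases hst.eq_or_lt with rfl | hlt
      · rw [sub_self, Real.zero_rpow (by linarith), Real.zero_rpow hα.ne']; simp
      · have hp : 0 < t - s := sub_pos.2 hlt
        calc s ^ (-β) * (t - s) ^ ρ ≤ (t - s) ^ (-β) * (t - s) ^ ρ := by
              exact mul_le_mul_of_nonneg_right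
                (Real.rpow_le_rpow_of_nonpos hp hts (by linarith)) (Real.rpow_nonneg hp.le _)
          _ = (t - s) ^ (ρ - β - α) * (t - s) ^ α := by
              rw [← Real.rpow_add hp, ← Real.rpow_add hp]; congr 1; ring
          _ ≤ _ := by
              exact mul_le_mul_of_nonneg_right
                (Real.rpow_le_rpow hp.le (by linarith) (by linarith)) hnn
    calc ‖R t s‖ = ‖(R t s - Ξ t s) + Ξ t s‖ := by rw [sub_add_cancel]
      _ ≤ sewingConst ρ * M * c₂ * (s ^ (-β) * (t - s) ^ ρ) + c₁ * (t - s) ^ α := by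
          refine (norm_add_le _ _).trans (add_le_add (e1.trans (le_of_eq (by ring))) e2)
      _ ≤ sewingConst ρ * M * (c₁ + c₂) * (T₀ ^ (ρ - β - α) * (t - s) ^ α) +
          (c₁ + c₂) * (t - s) ^ α := by
          have : 0 ≤ s ^ (-β) * (t - s) ^ ρ := by
            have := Real.rpow_nonneg hs.le (-β)
            have := Real.rpow_nonneg (by linarith : 0 ≤ t - s) ρ
            positivity
          gcongr <;> linarith
      _ = _ := by rw [hK₀]; ring
  have hRb : ∀ s t, 0 < s → s ≤ t → t ≤ T → ‖R t s‖ ≤ (K₁ * (c₁ + c₂)) * (t - s) ^ α := by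
    intro s t hs hst htT
    refine (norm_le_of_near hS hα (by positivity) hM0 hM' hR hnear hs hst htT).trans
      (le_of_eq ?_)
    rw [hK₁]; ring
  obtain ⟨I, hI0, hIR, hIb⟩ := exists_path_of_increments hα hM0 hM' hR hRb
  refine ⟨I, continuousOn_of_hatDelta_le hS hω hα hIb, hI0, fun s t hs hst htT => ?_,
    fun s t hs hst htT => ?_⟩
  · refine (hIb s t hs hst htT).trans ?_
    have hnn : 0 ≤ (t - s) ^ α := Real.rpow_nonneg (by linarith) _
    have : 0 ≤ sewingConst ρ * M := by positivity
    gcongr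
    linarith
  · rw [hIR s t hs hst htT]
    refine (hRΞ s t hs hst htT).trans ?_
    have h1 : 0 ≤ (t - s) ^ ρ := Real.rpow_nonneg (by linarith) _
    have h2 : 0 ≤ s ^ (-β) := Real.rpow_nonneg hs.le _
    gcongr
    linarith

/-- Uniqueness in the sewing lemma for semigroups. -/
theorem IsSewing.eqOn (hS : IsC0Semigroup S) {ω : ℝ} (hω : GrowthBoundLT S ω) (hρ : 1 < ρ)
    (hβ : 0 ≤ β) {I J : ℝ → W} (hI : IsSewing S T α β ρ c₁ c₂ Ξ I)
    (hJ : IsSewing S T α β ρ c₁ c₂ Ξ J) : EqOn J I (Icc 0 T) := by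
  obtain ⟨M, hM1, hM⟩ := hω.exists_bound T
  obtain ⟨K, -, hK⟩ := hI.bounds
  obtain ⟨K', -, hK'⟩ := hJ.bounds
  intro t ht
  rcases ht.1.eq_or_lt with rfl | ht0
  · rw [hI.map_zero, hJ.map_zero]
  set y : ℝ → W := fun s => J s - I s with hy
  have hyc : ContinuousOn y (Icc 0 T) := hJ.continuousOn.sub hI.continuousOn
  -- the orbit map `s ↦ S (t - s) (y s)` is constant on `(0, t]`
  have hconst : ∀ s, 0 < s → s ≤ t → y t = S (t - s) (y s) := by
    intro s hs hst
    have h := eq_of_norm_sub_le_rpow (D := fun v => S (t - v) (y v)) (a := s) (b := t)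
      (K := M * ((|K' * c₂| + |K * c₂|) * s ^ (-β))) hρ hst (by
        intro u v hu huv hv
        have e1 := hK u v (by linarith) huv (hv.trans ht.2)
        have e2 := hK' u v (by linarith) huv (hv.trans ht.2)
        have e : S (t - v) (y v) - S (t - u) (y u) =
            S (t - v) ((hatDelta S J v u - Ξ v u) - (hatDelta S I v u - Ξ v u)) := by
          simp only [hatDelta, hy]
          have : S (t - u) (J u - I u) = S (t - v) (S (v - u) (J u - I u)) := by
            rw [hS.apply_apply (by linarith) (by linarith), show t - v + (v - u) = t - u by ring]
          rw [this, ← map_sub, map_sub (S (v - u))]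
          congr 1; abel
        simp only [e]
        have hnn : 0 ≤ (v - u) ^ ρ := Real.rpow_nonneg (by linarith) _
        have h1 : u ^ (-β) ≤ s ^ (-β) := Real.rpow_le_rpow_of_nonpos hs hu (by linarith)
        have h2 : 0 ≤ u ^ (-β) := Real.rpow_nonneg (by linarith) _
        calc _ ≤ M * ‖(hatDelta S J v u - Ξ v u) - (hatDelta S I v u - Ξ v u)‖ :=
              (S (t - v)).le_of_opNorm_le (hM _ (by linarith) (by linarith [ht.2])) _
          _ ≤ M * (|K' * c₂| * s ^ (-β) * (v - u) ^ ρ + |K * c₂| * s ^ (-β) * (v - u) ^ ρ) := by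
              gcongr
              refine (norm_sub_le _ _).trans (add_le_add (e2.trans ?_) (e1.trans ?_))
              · gcongr
                exact le_abs_self _
              · gcongr
                exact le_abs_self _
          _ = _ := by ring)
    simpa [hS.zero_apply] using h
  have hlim : Tendsto (fun s => M * ‖y s‖) (𝓝[>] 0) (𝓝 0) := by
    have h1 : Tendsto y (𝓝[>] 0) (𝓝 (y 0)) := by
      have h2 := (hyc 0 ⟨le_rfl, ht.1.trans ht.2⟩).tendsto
      refine h2.mono_left ?_
      rw [← nhdsWithin_Ioc_eq_nhdsGT (ht0.trans_le ht.2)]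
      exact nhdsWithin_mono _ Ioc_subset_Icc_self
    have h0 : y 0 = 0 := by simp [hy, hI.map_zero, hJ.map_zero]
    rw [h0] at h1
    simpa using h1.norm.const_mul M
  have hle : ‖y t‖ ≤ 0 := by
    refine ge_of_tendsto hlim ?_
    filter_upwards [Ioc_mem_nhdsGT ht0] with s hs
    rw [hconst s hs.1 hs.2]
    exact (S (t - s)).le_of_opNorm_le (hM _ (by linarith [hs.2]) (by linarith [hs.1, ht.2])) _
  exact sub_eq_zero.1 (norm_le_zero_iff.1 hle)

end Sewing

/-! ### Integrals of Beta type -/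

/-- The constant `∫₀^∞ q^{-a} / (1 + q) dq`. -/
def betaConst (a : ℝ) : ℝ := ∫ q in Ioi (0 : ℝ), q ^ (-a) * (1 + q)⁻¹

lemma integrableOn_betaConst {a : ℝ} (ha0 : 0 < a) (ha1 : a < 1) :
    IntegrableOn (fun q : ℝ => q ^ (-a) * (1 + q)⁻¹) (Ioi 0) := by
  have hcont : ContinuousOn (fun q : ℝ => q ^ (-a) * (1 + q)⁻¹) (Ioi 0) := by
    refine ContinuousOn.mul (fun q hq => ?_) (fun q hq => ?_)
    · exact (Real.continuousAt_rpow_const q _ (Or.inl (ne_of_gt hq))).continuousWithinAt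
    · have : (1 + q) ≠ 0 := by have := mem_Ioi.1 hq; positivity
      exact ((continuousAt_const.add continuousAt_id).inv₀ this).continuousWithinAt
  rw [← Ioc_union_Ioi_eq_Ioi zero_le_one]
  refine IntegrableOn.union ?_ ?_
  · have h1 : IntegrableOn (fun q : ℝ => q ^ (-a)) (Ioc 0 1) := by
      rw [← intervalIntegrable_iff_integrableOn_Ioc_of_le zero_le_one]
      exact intervalIntegral.intervalIntegrable_rpow' (by linarith)
    refine Integrable.mono' h1 ((hcont.mono Ioc_subset_Ioi_self).aestronglyMeasurable
      measurableSet_Ioc) ((ae_restrict_iff' measurableSet_Ioc).2 (Eventually.of_forall ?_))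
    intro q hq
    have hq0 := hq.1
    rw [Real.norm_of_nonneg (by positivity)]
    exact mul_le_of_le_one_right (by positivity) (inv_le_one_of_one_le₀ (by linarith))
  · have h1 : IntegrableOn (fun q : ℝ => q ^ (-a - 1)) (Ioi 1) :=
      integrableOn_Ioi_rpow_of_lt (by linarith) one_pos
    refine Integrable.mono' h1 ((hcont.mono (Ioi_subset_Ioi zero_le_one)).aestronglyMeasurable
      measurableSet_Ioi) ((ae_restrict_iff' measurableSet_Ioi).2 (Eventually.of_forall ?_))
    intro q hq
    have hq0 : 0 < q := one_pos.trans hq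
    rw [Real.norm_of_nonneg (by positivity), Real.rpow_sub hq0, Real.rpow_one, div_eq_mul_inv]
    gcongr
    linarith

lemma betaConst_pos {a : ℝ} (ha0 : 0 < a) (ha1 : a < 1) : 0 < betaConst a := by
  have hpos : ∀ q ∈ Ioi (0 : ℝ), 0 < q ^ (-a) * (1 + q)⁻¹ := fun q hq => by
    have := mem_Ioi.1 hq; positivity
  refine (setIntegral_pos_iff_support_of_nonneg_ae
    ((ae_restrict_iff' measurableSet_Ioi).2 (Eventually.of_forall fun q hq => (hpos q hq).le))
    (integrableOn_betaConst ha0 ha1)).2 ?_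
  have hsupp : Ioi (0 : ℝ) ⊆ Function.support fun q : ℝ => q ^ (-a) * (1 + q)⁻¹ :=
    fun q hq => (hpos q hq).ne'
  rw [inter_eq_right.2 hsupp]
  simp

lemma integrableOn_rpow_div_add {a h : ℝ} (ha0 : 0 < a) (ha1 : a < 1) (hh : 0 < h) :
    IntegrableOn (fun r : ℝ => r ^ (-a) * (r + h)⁻¹) (Ioi 0) ∧
      ∫ r in Ioi (0 : ℝ), r ^ (-a) * (r + h)⁻¹ = betaConst a * h ^ (-a) := by
  have hscale : ∀ q ∈ Ioi (0 : ℝ), (h * q) ^ (-a) * (h * q + h)⁻¹ =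
      h ^ (-a) * h⁻¹ * (q ^ (-a) * (1 + q)⁻¹) := fun q hq => by
    have hq0 := mem_Ioi.1 hq
    rw [Real.mul_rpow hh.le hq0.le, show h * q + h = h * (1 + q) by ring, mul_inv]
    ring
  constructor
  · have := (integrableOn_Ioi_comp_mul_left_iff (fun r : ℝ => r ^ (-a) * (r + h)⁻¹) 0 hh).1
    rw [mul_zero] at this
    refine this (((integrableOn_betaConst ha0 ha1).const_mul (h ^ (-a) * h⁻¹)).congr ?_)
    exact (ae_restrict_iff' measurableSet_Ioi).2
      (Eventually.of_forall fun q hq => (hscale q hq).symm)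
  · have := integral_comp_mul_left_Ioi (fun r : ℝ => r ^ (-a) * (r + h)⁻¹) 0 hh
    rw [mul_zero, setIntegral_congr_fun measurableSet_Ioi hscale, integral_const_mul] at this
    rw [smul_eq_mul, eq_inv_mul_iff_mul_eq₀ hh.ne'] at this
    rw [← this, betaConst]
    field_simp

/-- The convolution identity behind `(ω - A)^{-a} (ω - A)^{-(1-a)} = (ω - A)^{-1}`. Substituting
`r = t q` turns the weights into `q ^ (-a)`, and the integral over `t` is then a mere rescaling. -/
lemma integral_rpow_smul_integral_rpow_smul {W : Type*} [NormedAddCommGroup W] [NormedSpace ℝ W]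
    [CompleteSpace W] {a : ℝ} (ha0 : 0 < a) (ha1 : a < 1) {φ : ℝ → W} (hφc : ContinuousOn φ (Ioi 0))
    (hφ : IntegrableOn φ (Ioi 0)) :
    ∫ t in Ioi (0 : ℝ), t ^ (a - 1) • ∫ r in Ioi (0 : ℝ), r ^ (-a) • φ (t + r) =
      betaConst a • ∫ u in Ioi (0 : ℝ), φ u := by
  have hsub : ∀ t ∈ Ioi (0 : ℝ), t ^ (a - 1) • ∫ r in Ioi (0 : ℝ), r ^ (-a) • φ (t + r) =
      ∫ q in Ioi (0 : ℝ), q ^ (-a) • φ ((1 + q) * t) := by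
    intro t ht
    have ht0 := mem_Ioi.1 ht
    have h1 := integral_comp_mul_left_Ioi (fun r : ℝ => r ^ (-a) • φ (t + r)) 0 ht0
    rw [mul_zero] at h1
    have h2 : ∀ q ∈ Ioi (0 : ℝ), (t * q) ^ (-a) • φ (t + t * q) =
        t ^ (-a) • (q ^ (-a) • φ ((1 + q) * t)) := fun q hq => by
      rw [Real.mul_rpow ht0.le (le_of_lt hq), mul_smul, show t + t * q = (1 + q) * t by ring]
    rw [setIntegral_congr_fun measurableSet_Ioi h2, integral_smul] at h1
    rw [eq_inv_smul_iff₀ ht0.ne'] at h1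
    rw [← h1, smul_smul, smul_smul, Real.rpow_sub ht0, Real.rpow_one, Real.rpow_neg ht0.le]
    have : t ^ a ≠ 0 := (Real.rpow_pos_of_pos ht0 a).ne'
    rw [show t ^ a / t * t * (t ^ a)⁻¹ = 1 by field_simp, one_smul]
  have hin : ∀ q ∈ Ioi (0 : ℝ), (0 : ℝ) < 1 + q := fun q hq => by
    have := mem_Ioi.1 hq; positivity
  have hint : Integrable (Function.uncurry fun (t q : ℝ) => q ^ (-a) • φ ((1 + q) * t))
      ((volume.restrict (Ioi (0 : ℝ))).prod (volume.restrict (Ioi (0 : ℝ)))) := by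
    have hmeas : AEStronglyMeasurable
        (Function.uncurry fun (t q : ℝ) => q ^ (-a) • φ ((1 + q) * t))
        ((volume.restrict (Ioi (0 : ℝ))).prod (volume.restrict (Ioi (0 : ℝ)))) := by
      rw [Measure.prod_restrict]
      refine ContinuousOn.aestronglyMeasurable ?_ (measurableSet_Ioi.prod measurableSet_Ioi)
      have hp : ContinuousOn (fun p : ℝ × ℝ => p.2 ^ (-a)) (Ioi 0 ×ˢ Ioi 0) := fun p hp =>
        (continuousAt_snd.rpow_const (Or.inl (ne_of_gt hp.2))).continuousWithinAt
      refine hp.smul ?_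
      refine hφc.comp (by fun_prop) fun p hp => ?_
      exact mul_pos (hin _ hp.2) hp.1
    refine (integrable_prod_iff' hmeas).2 ⟨?_, ?_⟩
    · refine (ae_restrict_iff' measurableSet_Ioi).2 (Eventually.of_forall fun q hq => ?_)
      have := (integrableOn_Ioi_comp_mul_left_iff φ 0 (hin q hq)).2
      rw [mul_zero] at this
      exact Integrable.smul (q ^ (-a)) (this hφ)
    · refine ((integrableOn_betaConst ha0 ha1).mul_const (∫ u in Ioi (0 : ℝ), ‖φ u‖)).congr ?_
      refine (ae_restrict_iff' measurableSet_Ioi).2 (Eventually.of_forall fun q hq => ?_)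
      have hq0 := mem_Ioi.1 hq
      have h1 := integral_comp_mul_left_Ioi (fun u : ℝ => ‖φ u‖) 0 (hin q hq)
      rw [mul_zero, smul_eq_mul] at h1
      simp only [Function.uncurry, norm_smul]
      rw [integral_const_mul, h1, Real.norm_of_nonneg (by positivity), mul_assoc]
  rw [setIntegral_congr_fun measurableSet_Ioi hsub, integral_integral_swap hint]
  have hin2 : ∀ q ∈ Ioi (0 : ℝ), ∫ t in Ioi (0 : ℝ), q ^ (-a) • φ ((1 + q) * t) =
      (q ^ (-a) * (1 + q)⁻¹) • ∫ u in Ioi (0 : ℝ), φ u := fun q hq => by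
    have h1 := integral_comp_mul_left_Ioi φ 0 (hin q hq)
    rw [mul_zero] at h1
    rw [integral_smul, h1, smul_smul]
  rw [setIntegral_congr_fun measurableSet_Ioi hin2, integral_smul_const, betaConst]

/-! ### Fractional powers of exponentially stable analytic semigroups -/

section Stable

variable {W : Type u} [NormedAddCommGroup W] [NormedSpace ℝ W]

/-- An exponentially stable semigroup with differentiable orbits whose derivative at time `t` is of
order `t⁻¹`; for `C₀`-semigroups this derivative bound is equivalent to analyticity. -/
structure IsStableAnalytic (V : ℝ → W →L[ℝ] W) (M κ C : ℝ) : Prop where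
  zero_apply : ∀ x, V 0 x = x
  apply_apply : ∀ s t x, 0 ≤ s → 0 ≤ t → V s (V t x) = V (s + t) x
  continuousOn : ∀ x, ContinuousOn (fun t => V t x) (Ici 0)
  M_nonneg : 0 ≤ M
  κ_pos : 0 < κ
  C_nonneg : 0 ≤ C
  bound : ∀ t, 0 ≤ t → ‖V t‖ ≤ M * Real.exp (-(κ * t))
  exists_hasDerivAt : ∀ x t, 0 < t → ∃ g : W, HasDerivAt (fun t => V t x) g t ∧ ‖g‖ ≤ C * t⁻¹ * ‖x‖

variable {V : ℝ → W →L[ℝ] W} {M κ C ε : ℝ}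

namespace IsStableAnalytic

lemma norm_le (hV : IsStableAnalytic V M κ C) {t : ℝ} (ht : 0 ≤ t) (x : W) :
    ‖V t x‖ ≤ M * Real.exp (-(κ * t)) * ‖x‖ :=
  (V t).le_of_opNorm_le (hV.bound t ht) x

lemma norm_le' (hV : IsStableAnalytic V M κ C) {t : ℝ} (ht : 0 ≤ t) (x : W) :
    ‖V t x‖ ≤ M * ‖x‖ := by
  refine (hV.norm_le ht x).trans ?_
  have h1 : Real.exp (-(κ * t)) ≤ 1 :=
    Real.exp_le_one_iff.2 (neg_nonpos.2 (mul_nonneg hV.κ_pos.le ht))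
  have := hV.M_nonneg
  gcongr
  exact mul_le_of_le_one_right this h1

lemma hasDerivAt (hV : IsStableAnalytic V M κ C) (x : W) {t : ℝ} (ht : 0 < t) :
    HasDerivAt (fun t => V t x) (deriv (fun t => V t x) t) t := by
  obtain ⟨g, hg, -⟩ := hV.exists_hasDerivAt x t ht
  exact hg.differentiableAt.hasDerivAt

lemma norm_deriv_le (hV : IsStableAnalytic V M κ C) (x : W) {t : ℝ} (ht : 0 < t) :
    ‖deriv (fun t => V t x) t‖ ≤ C * t⁻¹ * ‖x‖ := by
  obtain ⟨g, hg, h⟩ := hV.exists_hasDerivAt x t ht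
  rwa [hg.deriv]

lemma apply_deriv (hV : IsStableAnalytic V M κ C) (x : W) {s t : ℝ} (hs : 0 ≤ s) (ht : 0 < t) :
    V s (deriv (fun t => V t x) t) = deriv (fun t => V t x) (s + t) := by
  have h1 : HasDerivAt (fun r => V s (V r x)) (V s (deriv (fun t => V t x) t)) t :=
    (V s).hasFDerivAt.comp_hasDerivAt t (hV.hasDerivAt x ht)
  have h2 : HasDerivAt (fun r => V (s + r) x) (deriv (fun t => V t x) (s + t)) t :=
    (hV.hasDerivAt x (by linarith : 0 < s + t)).comp_const_add s t
  refine h1.unique (h2.congr_of_eventuallyEq ?_)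
  filter_upwards [Ioi_mem_nhds ht] with r hr
  exact hV.apply_apply s r x hs (le_of_lt hr)

lemma integrableOn_exp_rpow (hκ : 0 < κ) (hε : 0 < ε) :
    IntegrableOn (fun t : ℝ => t ^ (ε - 1) * Real.exp (-(κ * t))) (Ioi 0) := by
  have := integrableOn_rpow_mul_exp_neg_mul_rpow (s := ε - 1) (p := 1) (b := κ) (by linarith)
    one_pos hκ
  simpa [Real.rpow_one] using this

lemma integrableOn_rpow_smul (hV : IsStableAnalytic V M κ C) (hε : 0 < ε) (x : W) :
    IntegrableOn (fun t : ℝ => t ^ (ε - 1) • V t x) (Ioi 0) := by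
  refine Integrable.mono' ((integrableOn_exp_rpow hV.κ_pos hε).mul_const (M * ‖x‖)) ?_
    ((ae_restrict_iff' measurableSet_Ioi).2 (Eventually.of_forall fun t ht => ?_))
  · refine ContinuousOn.aestronglyMeasurable ?_ measurableSet_Ioi
    refine ContinuousOn.smul (fun q hq => ?_) ((hV.continuousOn x).mono Ioi_subset_Ici_self)
    exact (Real.continuousAt_rpow_const q _ (Or.inl (ne_of_gt hq))).continuousWithinAt
  · have ht0 := mem_Ioi.1 ht
    have h1 : 0 ≤ t ^ (ε - 1) := Real.rpow_nonneg ht0.le _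
    rw [norm_smul, Real.norm_of_nonneg h1]
    calc _ ≤ t ^ (ε - 1) * (M * Real.exp (-(κ * t)) * ‖x‖) := by
          gcongr; exact hV.norm_le ht0.le x
      _ = _ := by ring

/-- The unnormalised negative fractional power is a bounded operator. -/
lemma exists_clm (hV : IsStableAnalytic V M κ C) (hε : 0 < ε) :
    ∃ N : W →L[ℝ] W, ∀ x, N x = ∫ t in Ioi (0 : ℝ), t ^ (ε - 1) • V t x := by
  let N₀ : W →ₗ[ℝ] W :=
    { toFun := fun x => ∫ t in Ioi (0 : ℝ), t ^ (ε - 1) • V t x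
      map_add' := fun x y => by
        rw [← integral_add (hV.integrableOn_rpow_smul hε x) (hV.integrableOn_rpow_smul hε y)]
        simp only [map_add, smul_add]
      map_smul' := fun c x => by
        rw [RingHom.id_apply, ← integral_smul]
        simp only [map_smul, smul_comm c] }
  refine ⟨N₀.mkContinuous ((∫ t in Ioi (0 : ℝ), t ^ (ε - 1) * Real.exp (-(κ * t))) * M)
    fun x => ?_, fun x => rfl⟩
  have h := norm_integral_le_of_norm_le (f := fun t : ℝ => t ^ (ε - 1) • V t x)
    ((integrableOn_exp_rpow hV.κ_pos hε).mul_const (M * ‖x‖))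
    ((ae_restrict_iff' measurableSet_Ioi).2 (Eventually.of_forall fun t ht => by
      have ht0 := mem_Ioi.1 ht
      have h1 : 0 ≤ t ^ (ε - 1) := Real.rpow_nonneg ht0.le _
      rw [norm_smul, Real.norm_of_nonneg h1]
      calc _ ≤ t ^ (ε - 1) * (M * Real.exp (-(κ * t)) * ‖x‖) := by
            gcongr; exact hV.norm_le ht0.le x
        _ = _ := by ring))
  rw [integral_mul_const] at h
  exact h.trans (le_of_eq (by ring))

lemma integrableOn_orbit (hV : IsStableAnalytic V M κ C) (x : W) :
    IntegrableOn (fun t : ℝ => V t x) (Ioi 0) := by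
  have := hV.integrableOn_rpow_smul one_pos x
  simpa using this

/-- The negative fractional powers are injective, because composing two of them gives the
resolvent, whose kernel is trivial. -/
lemma eq_zero_of_integral_eq_zero [CompleteSpace W] (hV : IsStableAnalytic V M κ C) (hε : 0 < ε)
    (hε1 : ε < 1) {x : W}
    (hx : ∫ t in Ioi (0 : ℝ), t ^ (ε - 1) • V t x = 0) : x = 0 := by
  have hres : ∀ h : ℝ, 0 ≤ h → ∫ u in Ioi (0 : ℝ), V (u + h) x = 0 := by
    intro h hh
    have hφc : ContinuousOn (fun u => V (u + h) x) (Ioi 0) := by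
      refine (hV.continuousOn x).comp (by fun_prop) fun u hu => ?_
      exact add_nonneg (le_of_lt hu) hh
    have hφ : IntegrableOn (fun u => V (u + h) x) (Ioi 0) := by
      refine (hV.integrableOn_orbit (V h x)).congr ?_
      exact (ae_restrict_iff' measurableSet_Ioi).2
        (Eventually.of_forall fun u hu => hV.apply_apply u h x (le_of_lt hu) hh)
    have h1 := integral_rpow_smul_integral_rpow_smul (a := 1 - ε) (by linarith) (by linarith)
      hφc hφ
    have h2 : ∀ t ∈ Ioi (0 : ℝ), t ^ (1 - ε - 1) •
        ∫ r in Ioi (0 : ℝ), r ^ (-(1 - ε)) • V (t + r + h) x = 0 := by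
      intro t ht
      have ht0 := mem_Ioi.1 ht
      have h3 : ∀ r ∈ Ioi (0 : ℝ), r ^ (-(1 - ε)) • V (t + r + h) x =
          V (t + h) (r ^ (ε - 1) • V r x) := fun r hr => by
        rw [map_smul, hV.apply_apply _ _ _ (by linarith) (le_of_lt hr), neg_sub,
          show t + h + r = t + r + h by ring]
      rw [setIntegral_congr_fun measurableSet_Ioi h3,
        ContinuousLinearMap.integral_comp_comm _ (hV.integrableOn_rpow_smul hε x), hx, map_zero,
        smul_zero]
    rw [setIntegral_congr_fun measurableSet_Ioi h2] at h1
    simp only [integral_zero] at h1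
    exact (smul_eq_zero.1 h1.symm).resolve_left (betaConst_pos (by linarith) (by linarith)).ne'
  have hzero : ∀ h : ℝ, 0 < h → ∫ u in (0 : ℝ)..h, V u x = 0 := by
    intro h hh
    have e0 : ∫ u in Ioi (0 : ℝ), V u x = 0 := by simpa using hres 0 le_rfl
    have e1 : ∫ u in Ioi h, V u x = 0 := by
      have := (measurePreserving_add_right volume h).setIntegral_preimage_emb
        (measurableEmbedding_addRight h) (fun u => V u x) (Ioi h)
      rw [preimage_add_const_Ioi, sub_self] at this
      rw [← this, hres h hh.le]
    have e2 := intervalIntegral.integral_Ioi_sub_Ioi (hV.integrableOn_orbit x) hh.le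
    rw [e0, e1, sub_zero] at e2
    exact e2.symm
  by_contra hne
  have hpos : 0 < ‖x‖ := norm_pos_iff.2 hne
  have hc := hV.continuousOn x 0 self_mem_Ici
  rw [ContinuousWithinAt, hV.zero_apply] at hc
  obtain ⟨δ, hδ, hball⟩ := Metric.mem_nhdsWithin_iff.1
    (Metric.tendsto_nhds.1 hc (‖x‖ / 2) (by linarith))
  have h4 : ‖∫ u in (0 : ℝ)..(δ / 2), (V u x - x)‖ ≤ ‖x‖ / 2 * |δ / 2 - 0| := by
    refine intervalIntegral.norm_integral_le_of_norm_le_const fun u hu => ?_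
    rw [uIoc_of_le (by linarith)] at hu
    have hu' : u ∈ Metric.ball 0 δ := by
      rw [Metric.mem_ball, Real.dist_eq, sub_zero, abs_of_pos hu.1]
      linarith [hu.2]
    have := hball ⟨hu', mem_Ici.2 hu.1.le⟩
    rw [mem_ofPred_eq, dist_eq_norm] at this
    exact this.le
  have hii : IntervalIntegrable (fun u => V u x) volume 0 (δ / 2) := by
    refine ContinuousOn.intervalIntegrable ?_
    rw [uIcc_of_le (by linarith)]
    exact (hV.continuousOn x).mono Icc_subset_Ici_self
  rw [intervalIntegral.integral_sub hii intervalIntegrable_const, hzero _ (by linarith),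
    intervalIntegral.integral_const, zero_sub, norm_neg, norm_smul, sub_zero,
    Real.norm_of_nonneg (by linarith), abs_of_pos (by linarith)] at h4
  nlinarith

/-- The smoothing effect: `V h` maps into the domain of the fractional power of order `ε`, with
norm of order `h ^ (-ε)`. The preimage of `V h x` is, up to a constant, the integral of
`r ^ (-ε)` against the negative derivative of the orbit at time `r + h`. -/
lemma exists_preimage [CompleteSpace W] (hV : IsStableAnalytic V M κ C) (hε : 0 < ε)
    (hε1 : ε < 1) {h : ℝ} (hh : 0 < h) (x : W) :
    ∃ y, ∫ t in Ioi (0 : ℝ), t ^ (ε - 1) • V t y = V h x ∧ ‖y‖ ≤ C * h ^ (-ε) * ‖x‖ := by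
  set g : ℝ → W := deriv fun t => V t x with hg
  have hc := betaConst_pos hε hε1
  have hgV : ∀ u, 0 ≤ u → g (u + h) = V u (g h) := fun u hu => (hV.apply_deriv x hu hh).symm
  have hφc : ContinuousOn (fun u => g (u + h)) (Ioi 0) :=
    ((hV.continuousOn (g h)).mono Ioi_subset_Ici_self).congr fun u hu => hgV u (le_of_lt hu)
  have hφ : IntegrableOn (fun u => g (u + h)) (Ioi 0) := by
    refine (hV.integrableOn_orbit (g h)).congr ?_
    exact (ae_restrict_iff' measurableSet_Ioi).2
      (Eventually.of_forall fun u hu => (hgV u (le_of_lt hu)).symm)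
  obtain ⟨hki, hke⟩ := integrableOn_rpow_div_add hε hε1 hh
  have hbd : ∀ r ∈ Ioi (0 : ℝ), ‖r ^ (-ε) • g (r + h)‖ ≤ r ^ (-ε) * (r + h)⁻¹ * (C * ‖x‖) := by
    intro r hr
    have hr0 := mem_Ioi.1 hr
    have h1 : 0 ≤ r ^ (-ε) := Real.rpow_nonneg hr0.le _
    rw [norm_smul, Real.norm_of_nonneg h1]
    calc _ ≤ r ^ (-ε) * (C * (r + h)⁻¹ * ‖x‖) := by
          gcongr; exact hV.norm_deriv_le x (by linarith)
      _ = _ := by ring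
  have hyi : IntegrableOn (fun r : ℝ => r ^ (-ε) • g (r + h)) (Ioi 0) := by
    refine Integrable.mono' (hki.mul_const (C * ‖x‖)) ?_
      ((ae_restrict_iff' measurableSet_Ioi).2 (Eventually.of_forall hbd))
    refine ContinuousOn.aestronglyMeasurable ?_ measurableSet_Ioi
    refine ContinuousOn.smul (fun q hq => ?_) hφc
    exact (Real.continuousAt_rpow_const q _ (Or.inl (ne_of_gt hq))).continuousWithinAt
  have hFTC : ∫ u in Ioi (0 : ℝ), g (u + h) = -V h x := by
    have h1 : ∀ u ∈ Ioi (0 : ℝ), HasDerivAt (fun u => V (u + h) x) (g (u + h)) u := fun u hu =>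
      (hV.hasDerivAt x (add_pos hu hh)).comp_add_const u h
    have h2 : Tendsto (fun u => V (u + h) x) atTop (𝓝 0) := by
      have h3 : Tendsto (fun u : ℝ => M * Real.exp (-(κ * u)) * ‖V h x‖) atTop (𝓝 0) := by
        have h4 : Tendsto (fun u : ℝ => Real.exp (-(κ * u))) atTop (𝓝 0) :=
          Real.tendsto_exp_neg_atTop_nhds_zero.comp (tendsto_id.const_mul_atTop hV.κ_pos)
        simpa using (h4.const_mul M).mul_const ‖V h x‖
      refine squeeze_zero_norm' ?_ h3
      filter_upwards [eventually_ge_atTop 0] with u hu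
      rw [← hV.apply_apply u h x hu hh.le]
      exact hV.norm_le hu _
    have h5 : ContinuousWithinAt (fun u => V (u + h) x) (Ici 0) 0 := by
      have : ContinuousOn (fun u => V (u + h) x) (Ici 0) := by
        refine (hV.continuousOn x).comp (by fun_prop) fun u hu => ?_
        exact add_nonneg hu hh.le
      exact this 0 self_mem_Ici
    have := integral_Ioi_of_hasDerivAt_of_tendsto h5 h1 hφ h2
    rwa [zero_add, zero_sub] at this
  set y₀ := ∫ r in Ioi (0 : ℝ), r ^ (-ε) • g (r + h) with hy₀
  have hconv := integral_rpow_smul_integral_rpow_smul hε hε1 hφc hφ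
  have hin : ∀ t ∈ Ioi (0 : ℝ), t ^ (ε - 1) • V t ((-(betaConst ε)⁻¹) • y₀) =
      (-(betaConst ε)⁻¹) • (t ^ (ε - 1) • ∫ r in Ioi (0 : ℝ), r ^ (-ε) • g (t + r + h)) := by
    intro t ht
    have ht0 := mem_Ioi.1 ht
    rw [map_smul, smul_comm, hy₀, ← ContinuousLinearMap.integral_comp_comm _ hyi]
    congr 2
    refine setIntegral_congr_fun measurableSet_Ioi fun r hr => ?_
    have hr0 := mem_Ioi.1 hr
    rw [map_smul, hV.apply_deriv x ht0.le (by linarith), add_assoc]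
  refine ⟨(-(betaConst ε)⁻¹) • y₀, ?_, ?_⟩
  · rw [setIntegral_congr_fun measurableSet_Ioi hin, integral_smul, hconv, hFTC, smul_neg,
      smul_neg, neg_smul, neg_neg, inv_smul_smul₀ hc.ne']
  · have h1 : ‖y₀‖ ≤ betaConst ε * h ^ (-ε) * (C * ‖x‖) := by
      have := norm_integral_le_of_norm_le (hki.mul_const (C * ‖x‖))
        ((ae_restrict_iff' measurableSet_Ioi).2 (Eventually.of_forall hbd))
      rwa [integral_mul_const, hke] at this
    rw [norm_smul, norm_neg, norm_inv, Real.norm_of_nonneg hc.le, inv_mul_le_iff₀ hc]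
    exact h1.trans (le_of_eq (by ring))

/-- Time regularity of orbits, in a form that is scaling invariant in `t` and `h`. -/
lemma norm_add_sub_le (hV : IsStableAnalytic V M κ C) {t h : ℝ} (ht : 0 < t) (hh : 0 < h) (x : W) :
    ‖V (t + h) x - V t x‖ ≤ (4 * M + 2 * C) * h * (t + h)⁻¹ * ‖x‖ := by
  have hM := hV.M_nonneg
  have hC := hV.C_nonneg
  have key : ‖V (t + h) x - V t x‖ * (t + h) ≤ (4 * M + 2 * C) * h * ‖x‖ := by
    rcases le_total t h with hth | hth
    · have h1 := (norm_sub_le (V (t + h) x) (V t x)).trans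
        (add_le_add (hV.norm_le' (by linarith) x) (hV.norm_le' ht.le x))
      calc _ ≤ (M * ‖x‖ + M * ‖x‖) * (h + h) := by gcongr
        _ = 4 * M * h * ‖x‖ := by ring
        _ ≤ _ := by gcongr; linarith
    · have h1 : ‖V (t + h) x - V t x‖ ≤ C * t⁻¹ * ‖x‖ * ‖t + h - t‖ := by
        refine Convex.norm_image_sub_le_of_norm_hasDerivWithin_le (s := Icc t (t + h))
          (f := fun u => V u x) (f' := deriv fun u => V u x)
          (fun u hu => (hV.hasDerivAt x (ht.trans_le hu.1)).hasDerivWithinAt) (fun u hu => ?_)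
          (convex_Icc _ _) (left_mem_Icc.2 (by linarith)) (right_mem_Icc.2 (by linarith))
        refine (hV.norm_deriv_le x (ht.trans_le hu.1)).trans ?_
        have := inv_anti₀ ht hu.1
        gcongr
      rw [add_sub_cancel_left, Real.norm_of_nonneg hh.le] at h1
      calc _ ≤ C * t⁻¹ * ‖x‖ * h * (t + t) := by gcongr
        _ = 2 * C * h * ‖x‖ := by field_simp; ring
        _ ≤ _ := by gcongr; linarith
  rw [← le_div_iff₀ (by linarith)] at key
  exact key.trans (le_of_eq (by rw [div_eq_mul_inv]; ring))

/-- Orbits that start in the domain of the fractional power of order `ε` are Hölder continuous of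
order `ε` at time `0`. -/
lemma norm_apply_sub_le [CompleteSpace W] (hV : IsStableAnalytic V M κ C) (hε : 0 < ε)
    (hε1 : ε < 1) {h : ℝ} (hh : 0 < h) (x : W) :
    ‖V h (∫ t in Ioi (0 : ℝ), t ^ (ε - 1) • V t x) - ∫ t in Ioi (0 : ℝ), t ^ (ε - 1) • V t x‖ ≤
      (4 * M + 2 * C) * betaConst (1 - ε) * h ^ ε * ‖x‖ := by
  have hi := hV.integrableOn_rpow_smul hε x
  obtain ⟨hki, hke⟩ := integrableOn_rpow_div_add (a := 1 - ε) (by linarith) (by linarith) hh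
  rw [← ContinuousLinearMap.integral_comp_comm _ hi,
    ← integral_sub ((V h).integrable_comp hi) hi]
  have hb := norm_integral_le_of_norm_le
    (f := fun t : ℝ => V h (t ^ (ε - 1) • V t x) - t ^ (ε - 1) • V t x)
    (hki.mul_const ((4 * M + 2 * C) * h * ‖x‖))
    ((ae_restrict_iff' measurableSet_Ioi).2 (Eventually.of_forall fun t ht => by
      have ht0 := mem_Ioi.1 ht
      have h1 : 0 ≤ t ^ (ε - 1) := Real.rpow_nonneg ht0.le _
      rw [map_smul, ← smul_sub, norm_smul, Real.norm_of_nonneg h1,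
        hV.apply_apply h t x hh.le ht0.le, add_comm h t, neg_sub]
      calc _ ≤ t ^ (ε - 1) * ((4 * M + 2 * C) * h * (t + h)⁻¹ * ‖x‖) := by
            gcongr; exact hV.norm_add_sub_le ht0 hh x
        _ = _ := by ring))
  rw [integral_mul_const, hke] at hb
  refine hb.trans (le_of_eq ?_)
  have : h ^ (-(1 - ε)) * h = h ^ ε := by
    rw [← Real.rpow_add_one hh.ne']; congr 1; ring
  rw [← this]
  ring

end IsStableAnalytic

end Stable

/-! ### Derivative bounds for analytic semigroups -/

/-- A disc around a positive real number `t`, with radius proportional to `t`, lies in the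
sector. -/
lemma exists_ball_subset_sector {θ : ℝ} (hθ : 0 < θ) :
    ∃ c : ℝ, 0 < c ∧ c < 1 ∧ ∀ t : ℝ, 0 < t → Metric.ball (t : ℂ) (c * t) ⊆ sector θ := by
  have h1 : ∀ᶠ z : ℂ in 𝓝 1, |z.arg| < θ := by
    have hc : ContinuousAt (fun z : ℂ => |z.arg|) 1 :=
      (Complex.continuousAt_arg Complex.one_mem_slitPlane).abs
    refine hc.tendsto.eventually (gt_mem_nhds ?_)
    simpa using hθ
  obtain ⟨δ, hδ, hball⟩ := Metric.eventually_nhds_iff.1 h1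
  have hc0 : 0 < min δ (1 / 2) := lt_min hδ (by norm_num)
  refine ⟨min δ (1 / 2), hc0, (min_le_right _ _).trans_lt (by norm_num), fun t ht z hz => ?_⟩
  have ht' : (t : ℂ) ≠ 0 := by exact_mod_cast ht.ne'
  have hz1 : dist (z / t) 1 < min δ (1 / 2) := by
    rw [dist_eq_norm, show z / t - 1 = (z - t) / t by field_simp, norm_div, Complex.norm_real,
      Real.norm_of_nonneg ht.le, div_lt_iff₀ ht, ← dist_eq_norm]
    exact hz
  have hz2 : z = (t : ℂ) * (z / t) := by field_simp
  refine ⟨?_, ?_⟩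
  · rintro rfl
    rw [zero_div, dist_eq_norm, zero_sub, norm_neg, norm_one] at hz1
    exact absurd (hz1.trans_le (min_le_right _ _)) (by norm_num)
  · rw [hz2, Complex.arg_real_mul _ ht]
    exact hball (hz1.trans_le (min_le_left _ _))

/-- By the uniform boundedness principle, a sectorial semigroup is bounded near `0`. -/
lemma IsSectorialSemigroup.exists_bound {E : Type u} [NormedAddCommGroup E] [NormedSpace ℂ E]
    [CompleteSpace E] {θ : ℝ} {U : ℂ → E →L[ℂ] E} (hU : IsSectorialSemigroup θ U) :
    ∃ δ B : ℝ, 0 < δ ∧ 0 ≤ B ∧ ∀ z ∈ sector θ, ‖z‖ < δ → ‖U z‖ ≤ B := by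
  by_contra! hcon
  have hseq : ∀ n : ℕ, ∃ z ∈ sector θ, ‖z‖ < 1 / ((n : ℝ) + 1) ∧ (n : ℝ) < ‖U z‖ := fun n =>
    hcon _ _ Nat.one_div_pos_of_nat (Nat.cast_nonneg n)
  choose z hzs hz0 hzU using hseq
  have hlim : Tendsto z atTop (𝓝[sector θ] 0) := by
    refine tendsto_nhdsWithin_iff.2 ⟨?_, Eventually.of_forall hzs⟩
    exact squeeze_zero_norm (fun n => (hz0 n).le) tendsto_one_div_add_atTop_nhds_zero_nat
  obtain ⟨C, hC⟩ := banach_steinhaus (g := fun n => U (z n)) fun x => by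
    obtain ⟨C, hC⟩ := isBounded_iff_forall_norm_le.1
      (Metric.isBounded_range_of_tendsto _ ((hU.tendsto_zero x).comp hlim))
    exact ⟨C, fun n => hC _ (mem_range_self n)⟩
  obtain ⟨n, hn⟩ := exists_nat_gt C
  exact absurd (hC n) (not_le.2 (hn.trans (hzU n)))

section

variable {W : Type u} [NormedAddCommGroup W] [NormedSpace ℝ W] [CompleteSpace W]
  {S : ℝ → W →L[ℝ] W}

/-- The Cauchy estimate on a disc of radius proportional to `t` bounds the derivative of the
orbits at small times `t`. The derivative stays in `W`, which is closed in its complexification. -/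
lemma IsAnalyticSemigroup.exists_hasDerivAt (hS : IsAnalyticSemigroup S) :
    ∃ r C : ℝ, 0 < r ∧ 0 ≤ C ∧ ∀ x t, 0 < t → t ≤ r →
      ∃ g : W, HasDerivAt (fun t => S t x) g t ∧ ‖g‖ ≤ C * t⁻¹ * ‖x‖ := by
  obtain ⟨E, _, _, _, ι, θ, U, -, hU, hUS⟩ := hS.analytic
  obtain ⟨δ, B, hδ, hB, hUB⟩ := hU.exists_bound
  obtain ⟨c, hc, hc1, hball⟩ := exists_ball_subset_sector hU.angle_pos
  refine ⟨δ / 4, B * (c / 2)⁻¹, by linarith, by positivity, fun x t ht htr => ?_⟩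
  have hclosed : Metric.closedBall (t : ℂ) (c / 2 * t) ⊆ Metric.ball (t : ℂ) (c * t) :=
    Metric.closedBall_subset_ball (by nlinarith)
  set f : ℂ → E := fun z => U z (ι x) with hf
  have hfd : DifferentiableOn ℂ f (Metric.ball (t : ℂ) (c * t)) := fun z hz => by
    have h1 := (hU.holomorphic.mono (hball t ht)) z hz
    exact h1.clm_apply (differentiableWithinAt_const _)
  have hcl : DiffContOnCl ℂ f (Metric.ball (t : ℂ) (c / 2 * t)) := by
    refine DifferentiableOn.diffContOnCl ?_
    rw [closure_ball _ (by positivity)]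
    exact hfd.mono hclosed
  have hsph : ∀ z ∈ Metric.sphere (t : ℂ) (c / 2 * t), ‖f z‖ ≤ B * ‖x‖ := by
    intro z hz
    have hzs := hball t ht (hclosed (Metric.sphere_subset_closedBall hz))
    have hzn : ‖z‖ < δ := by
      have h1 : ‖z - t‖ = c / 2 * t := by rw [← dist_eq_norm]; exact hz
      have h2 : ‖z‖ ≤ ‖z - t‖ + ‖(t : ℂ)‖ := by
        simpa using norm_add_le (z - t) (t : ℂ)
      rw [h1, Complex.norm_real, Real.norm_of_nonneg ht.le] at h2
      nlinarith
    have := (U z).le_of_opNorm_le (hUB z hzs hzn) (ι x)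
    rwa [ι.norm_map] at this
  have hder := Complex.norm_deriv_le_of_forall_mem_sphere_norm_le (by positivity) hcl hsph
  have hfat : HasDerivAt f (deriv f t) (t : ℂ) :=
    (hfd.differentiableAt (Metric.ball_mem_nhds _ (by positivity))).hasDerivAt
  have hreal : HasDerivAt (fun s : ℝ => ι (S s x)) (deriv f t) t := by
    have h1 : HasDerivAt (fun s : ℝ => f s) (deriv f t) t := by
      have h2 := hfat.scomp t Complex.ofRealCLM.hasDerivAt
      simpa [Function.comp_def] using h2
    refine h1.congr_of_eventuallyEq ?_
    filter_upwards [Ioi_mem_nhds ht] with s hs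
    exact (hUS s hs x).symm
  have hslope : Tendsto (fun s => ι (slope (fun s => S s x) t s)) (𝓝[≠] t) (𝓝 (deriv f t)) := by
    refine (hasDerivAt_iff_tendsto_slope.1 hreal).congr fun s => ?_
    simp only [slope, vsub_eq_sub, map_smul, map_sub]
  have hrange : deriv f t ∈ range ι :=
    (ι.isometry.isClosedEmbedding.isClosed_range).mem_of_tendsto hslope
      (Eventually.of_forall fun s => mem_range_self _)
  obtain ⟨g, hg⟩ := hrange
  refine ⟨g, ?_, ?_⟩
  · rw [← hg] at hslope
    exact hasDerivAt_iff_tendsto_slope.2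
      ((ι.isometry.isEmbedding.tendsto_nhds_iff).2 hslope)
  · rw [← ι.norm_map g, hg]
    refine hder.trans (le_of_eq ?_)
    field_simp

/-- Rescaling an analytic semigroup by `e^{-ωt}`, with `ω` larger than the growth bound, makes it
exponentially stable. -/
theorem IsAnalyticSemigroup.exists_isStableAnalytic (hS : IsAnalyticSemigroup S) {ω : ℝ}
    (hω : GrowthBoundLT S ω) :
    ∃ M κ C : ℝ, IsStableAnalytic (fun t => Real.exp (-(ω * t)) • S t) M κ C := by
  obtain ⟨r, C₀, hr, hC₀, hd⟩ := hS.exists_hasDerivAt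
  have hS' := hS.toIsC0Semigroup
  obtain ⟨M', ω', hω', hM'⟩ := id hω
  set V : ℝ → W →L[ℝ] W := fun t => Real.exp (-(ω * t)) • S t with hV
  have hVx : ∀ t x, V t x = Real.exp (-(ω * t)) • S t x := fun t x => rfl
  have hκ : 0 < ω - ω' := sub_pos.2 hω'
  set κ := ω - ω' with hκdef
  set M := |M'| with hM
  have hM0 : 0 ≤ M := abs_nonneg _
  have hVadd : ∀ s t x, 0 ≤ s → 0 ≤ t → V s (V t x) = V (s + t) x := fun s t x hs ht => by
    rw [hVx, hVx, hVx, map_smul, smul_smul, ← Real.exp_add, hS'.apply_apply hs ht]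
    congr 2; ring
  have hVb : ∀ t, 0 ≤ t → ‖V t‖ ≤ M * Real.exp (-(κ * t)) := fun t ht => by
    rw [hV]
    simp only [norm_smul]
    rw [Real.norm_of_nonneg (Real.exp_pos _).le]
    calc _ ≤ Real.exp (-(ω * t)) * (M * Real.exp (ω' * t)) := by
          gcongr
          refine (hM' t ht).trans ?_
          gcongr
          exact le_abs_self _
      _ = M * (Real.exp (-(ω * t)) * Real.exp (ω' * t)) := by ring
      _ = _ := by rw [← Real.exp_add]; congr 2; rw [hκdef]; ring
  have hVb' : ∀ t x, 0 ≤ t → ‖V t x‖ ≤ M * Real.exp (-(κ * t)) * ‖x‖ := fun t x ht =>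
    (V t).le_of_opNorm_le (hVb t ht) x
  -- short times
  set C₁ := |ω| * M * r + Real.exp (|ω| * r) * C₀ with hC₁
  have hC₁0 : 0 ≤ C₁ := by positivity
  have hshort : ∀ x t, 0 < t → t ≤ r →
      ∃ g : W, HasDerivAt (fun t => V t x) g t ∧ ‖g‖ ≤ C₁ * t⁻¹ * ‖x‖ := by
    intro x t ht htr
    obtain ⟨g, hg, hgb⟩ := hd x t ht htr
    have he : HasDerivAt (fun t : ℝ => Real.exp (-(ω * t))) (Real.exp (-(ω * t)) * -ω) t := by
      have h1 : HasDerivAt (fun t : ℝ => -(ω * t)) (-ω) t := by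
        simpa using ((hasDerivAt_id t).const_mul ω).fun_neg
      exact h1.exp
    refine ⟨_, he.smul hg, ?_⟩
    have h1 : ‖V t x‖ ≤ M * ‖x‖ := by
      refine (hVb' t x ht.le).trans ?_
      have : Real.exp (-(κ * t)) ≤ 1 :=
        Real.exp_le_one_iff.2 (neg_nonpos.2 (mul_nonneg hκ.le ht.le))
      gcongr
      exact mul_le_of_le_one_right hM0 this
    have h2 : Real.exp (-(ω * t)) ≤ Real.exp (|ω| * r) := by
      refine Real.exp_le_exp.2 ?_
      calc -(ω * t) = -ω * t := by ring
        _ ≤ |ω| * r := mul_le_mul (neg_le_abs ω) htr ht.le (abs_nonneg _)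
    have h3 : 1 ≤ r * t⁻¹ := by rw [← div_eq_mul_inv]; exact (one_le_div ht).2 htr
    have e1 : (Real.exp (-(ω * t)) * -ω) • S t x = (-ω) • V t x := by
      rw [hVx, smul_smul, mul_comm]
    calc ‖Real.exp (-(ω * t)) • g + (Real.exp (-(ω * t)) * -ω) • S t x‖
        ≤ Real.exp (-(ω * t)) * ‖g‖ + |ω| * ‖V t x‖ := by
          rw [e1]
          refine (norm_add_le _ _).trans (le_of_eq ?_)
          rw [norm_smul, norm_smul, Real.norm_of_nonneg (Real.exp_pos _).le, norm_neg,
            Real.norm_eq_abs]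
      _ ≤ Real.exp (|ω| * r) * (C₀ * t⁻¹ * ‖x‖) + |ω| * (M * ‖x‖) * (r * t⁻¹) := by
          refine add_le_add (mul_le_mul h2 hgb (norm_nonneg _) (Real.exp_pos _).le) ?_
          calc |ω| * ‖V t x‖ ≤ |ω| * (M * ‖x‖) := by gcongr
            _ ≤ _ := le_mul_of_one_le_right (by positivity) h3
      _ = _ := by rw [hC₁]; ring
  refine ⟨M, κ, max C₁ (M * (κ⁻¹ + r) * (C₁ * r⁻¹)), ?_, hVadd, ?_, hM0, hκ,
    hC₁0.trans (le_max_left _ _), hVb, fun x t ht => ?_⟩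
  · intro x
    rw [hVx, hS'.zero_apply]; simp
  · intro x
    have h1 : Continuous fun t : ℝ => Real.exp (-(ω * t)) := by fun_prop
    exact h1.continuousOn.smul (hS'.continuousOn hω x)
  rcases le_total t r with htr | htr
  · obtain ⟨g, hg, hgb⟩ := hshort x t ht htr
    refine ⟨g, hg, hgb.trans ?_⟩
    gcongr
    exact le_max_left _ _
  -- long times: the derivative at time `r` is transported by the semigroup
  · obtain ⟨g, hg, hgb⟩ := hshort x r hr le_rfl
    refine ⟨V (t - r) g, ?_, ?_⟩
    · have h1 : HasDerivAt (fun s => V (t - r) (V s x)) (V (t - r) g) (t - (t - r)) := by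
        rw [sub_sub_cancel]
        exact (V (t - r)).hasFDerivAt.comp_hasDerivAt r hg
      have h2 := h1.comp_sub_const t (t - r)
      refine h2.congr_of_eventuallyEq ?_
      filter_upwards [Ioi_mem_nhds (show t - r < t by linarith)] with s hs
      rw [hVadd _ _ _ (by linarith) (sub_nonneg.2 (le_of_lt hs)), add_sub_cancel]
    · have h1 : t * Real.exp (-(κ * (t - r))) ≤ κ⁻¹ + r := by
        have hy : 0 ≤ t - r := by linarith
        have h2 : κ * (t - r) * Real.exp (-(κ * (t - r))) ≤ 1 := by
          rw [Real.exp_neg, ← div_eq_mul_inv, div_le_one (Real.exp_pos _)]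
          linarith [Real.add_one_le_exp (κ * (t - r))]
        have h3 : Real.exp (-(κ * (t - r))) ≤ 1 :=
          Real.exp_le_one_iff.2 (neg_nonpos.2 (mul_nonneg hκ.le hy))
        have h4 : (t - r) * Real.exp (-(κ * (t - r))) ≤ κ⁻¹ := by
          rw [← one_div, le_div_iff₀ hκ]; linarith
        nlinarith
      have h5 : Real.exp (-(κ * (t - r))) ≤ (κ⁻¹ + r) * t⁻¹ := by
        rw [← div_eq_mul_inv, le_div_iff₀ ht]; linarith
      calc _ ≤ M * Real.exp (-(κ * (t - r))) * ‖g‖ := hVb' _ _ (by linarith)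
        _ ≤ M * ((κ⁻¹ + r) * t⁻¹) * (C₁ * r⁻¹ * ‖x‖) := by gcongr
        _ = M * (κ⁻¹ + r) * (C₁ * r⁻¹) * t⁻¹ * ‖x‖ := by ring
        _ ≤ _ := by gcongr; exact le_max_right _ _

end

/-! ### Fractional powers of the generator -/

lemma abs_exp_sub_one_le_mul_exp (x : ℝ) : |Real.exp x - 1| ≤ |x| * Real.exp |x| := by
  have h0 : 0 ≤ |x| := abs_nonneg x
  have h1 : 1 ≤ Real.exp |x| := Real.one_le_exp h0
  refine abs_le.2 ⟨?_, ?_⟩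
  · nlinarith [Real.add_one_le_exp x, neg_abs_le x]
  · have h2 : Real.exp x ≤ Real.exp |x| := Real.exp_le_exp.2 (le_abs_self x)
    have h3 : (1 - |x|) * Real.exp |x| ≤ Real.exp (-|x|) * Real.exp |x| := by
      gcongr
      linarith [Real.add_one_le_exp (-|x|)]
    rw [← Real.exp_add, neg_add_cancel, Real.exp_zero] at h3
    linarith

lemma exp_mul_le {ω h T : ℝ} (h0 : 0 ≤ h) (hT : h ≤ T) :
    Real.exp (ω * h) ≤ Real.exp (|ω| * T) :=
  Real.exp_le_exp.2 (mul_le_mul (le_abs_self ω) hT h0 (abs_nonneg _))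

section FracPow

variable {W : Type u} [NormedAddCommGroup W] [NormedSpace ℝ W] {S : ℝ → W →L[ℝ] W}
  {ω ε M κ C T₀ : ℝ}

lemma negFracPow_zero_right (x : W) : negFracPow S ω 0 x = x := if_pos rfl

lemma negFracPow_eq (hε : ε ≠ 0) (x : W) : negFracPow S ω ε x =
    (Real.Gamma ε)⁻¹ •
      ∫ t in Ioi (0 : ℝ), t ^ (ε - 1) • (Real.exp (-(ω * t)) • S t) x := by
  simp only [negFracPow, if_neg hε, mul_smul, smul_apply]

lemma exp_smul_rescaled (t : ℝ) (x : W) :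
    Real.exp (ω * t) • (Real.exp (-(ω * t)) • S t) x = S t x := by
  rw [smul_apply, smul_smul, ← Real.exp_add, add_neg_cancel, Real.exp_zero,
    one_smul]

/-- The negative fractional power is a bounded operator. -/
lemma exists_clm_negFracPow (hV : IsStableAnalytic (fun t => Real.exp (-(ω * t)) • S t) M κ C)
    (hε : 0 ≤ ε) : ∃ N : W →L[ℝ] W, ∀ x, N x = negFracPow S ω ε x := by
  rcases hε.eq_or_lt with rfl | hε
  · exact ⟨ContinuousLinearMap.id ℝ W, fun x => (negFracPow_zero_right x).symm⟩
  · obtain ⟨N, hN⟩ := hV.exists_clm hε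
    refine ⟨(Real.Gamma ε)⁻¹ • N, fun x => ?_⟩
    rw [negFracPow_eq hε.ne', smul_apply, hN]

lemma negFracPow_injective [CompleteSpace W]
    (hV : IsStableAnalytic (fun t => Real.exp (-(ω * t)) • S t) M κ C)
    (hε : 0 ≤ ε) (hε1 : ε < 1) : Function.Injective (negFracPow S ω ε) := by
  obtain ⟨N, hN⟩ := exists_clm_negFracPow hV hε
  have hNe : negFracPow S ω ε = N := funext fun x => (hN x).symm
  rw [hNe]
  refine (injective_iff_map_eq_zero N).2 fun x hx => ?_
  rw [hN] at hx
  rcases hε.eq_or_lt with rfl | hε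
  · rwa [negFracPow_zero_right] at hx
  · rw [negFracPow_eq hε.ne'] at hx
    exact hV.eq_zero_of_integral_eq_zero hε hε1
      ((smul_eq_zero.1 hx).resolve_left (inv_pos.2 (Real.Gamma_pos_of_pos hε)).ne')

/-- The smoothing effect of an analytic semigroup. -/
lemma exists_negFracPow_eq_apply [CompleteSpace W]
    (hV : IsStableAnalytic (fun t => Real.exp (-(ω * t)) • S t) M κ C)
    (hε : 0 < ε) (hε1 : ε < 1) (T₀ : ℝ) :
    ∃ D : ℝ, 0 ≤ D ∧ ∀ h x, 0 < h → h ≤ T₀ →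
      ∃ y, negFracPow S ω ε y = S h x ∧ ‖y‖ ≤ D * h ^ (-ε) * ‖x‖ := by
  have hG := Real.Gamma_pos_of_pos hε
  have hC := hV.C_nonneg
  refine ⟨Real.Gamma ε * Real.exp (|ω| * T₀) * C, by positivity, fun h x hh hhT => ?_⟩
  obtain ⟨y, hy, hyb⟩ := hV.exists_preimage hε hε1 hh x
  obtain ⟨N, hN⟩ := hV.exists_clm hε
  refine ⟨(Real.Gamma ε * Real.exp (ω * h)) • y, ?_, ?_⟩
  · rw [negFracPow_eq hε.ne', ← hN, map_smul, hN, hy, smul_smul, ← mul_assoc,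
      inv_mul_cancel₀ hG.ne', one_mul, exp_smul_rescaled]
  · rw [norm_smul, Real.norm_of_nonneg (by positivity)]
    calc _ ≤ Real.Gamma ε * Real.exp (|ω| * T₀) * (C * h ^ (-ε) * ‖x‖) := by
          gcongr Real.Gamma ε * ?_ * ?_
          exact exp_mul_le hh.le hhT
      _ = _ := by ring

/-- Orbits that start in `D_ε` are Hölder continuous of order `ε` at time `0`. -/
lemma exists_norm_apply_negFracPow_sub_le [CompleteSpace W] (hS : IsC0Semigroup S)
    (hV : IsStableAnalytic (fun t => Real.exp (-(ω * t)) • S t) M κ C)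
    (hε : 0 ≤ ε) (hε1 : ε < 1) (hT₀ : 0 < T₀) :
    ∃ D : ℝ, 0 ≤ D ∧ ∀ h x, 0 ≤ h → h ≤ T₀ →
      ‖S h (negFracPow S ω ε x) - negFracPow S ω ε x‖ ≤ D * h ^ ε * ‖x‖ := by
  have hM := hV.M_nonneg
  have hC := hV.C_nonneg
  rcases hε.eq_or_lt with rfl | hε
  · refine ⟨Real.exp (|ω| * T₀) * M + 1, by positivity, fun h x hh hhT => ?_⟩
    rw [negFracPow_zero_right, Real.rpow_zero, mul_one, add_mul, one_mul]
    refine (norm_sub_le _ _).trans (add_le_add ?_ le_rfl)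
    rw [← exp_smul_rescaled (ω := ω) (S := S), norm_smul, Real.norm_of_nonneg (Real.exp_pos _).le,
      mul_assoc]
    exact mul_le_mul (exp_mul_le hh hhT) (hV.norm_le' hh x) (norm_nonneg _) (Real.exp_pos _).le
  · have hG := Real.Gamma_pos_of_pos hε
    have hb := betaConst_pos (a := 1 - ε) (by linarith) (by linarith)
    obtain ⟨N, hN⟩ := exists_clm_negFracPow hV hε.le
    refine ⟨Real.exp (|ω| * T₀) * ((Real.Gamma ε)⁻¹ * ((4 * M + 2 * C) * betaConst (1 - ε))) +
      |ω| * Real.exp (|ω| * T₀) * T₀ ^ (1 - ε) * ‖N‖, by positivity, fun h x hh hhT => ?_⟩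
    rcases hh.eq_or_lt with rfl | hh
    · rw [hS.zero_apply, sub_self, norm_zero]
      positivity
    set z := negFracPow S ω ε x with hz
    set V : ℝ → W →L[ℝ] W := fun t => Real.exp (-(ω * t)) • S t with hVdef
    have e1 : S h z - z = Real.exp (ω * h) • (V h z - z) + (Real.exp (ω * h) - 1) • z := by
      rw [smul_sub, exp_smul_rescaled, sub_smul, one_smul]; abel
    have e2 : ‖V h z - z‖ ≤
        (Real.Gamma ε)⁻¹ * ((4 * M + 2 * C) * betaConst (1 - ε) * h ^ ε * ‖x‖) := by
      rw [hz, negFracPow_eq hε.ne', map_smul, ← smul_sub, norm_smul,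
        Real.norm_of_nonneg (inv_pos.2 hG).le]
      gcongr
      exact hV.norm_apply_sub_le hε hε1 hh x
    have e3 : |Real.exp (ω * h) - 1| ≤ |ω| * Real.exp (|ω| * T₀) * T₀ ^ (1 - ε) * h ^ ε := by
      refine (abs_exp_sub_one_le_mul_exp _).trans ?_
      rw [abs_mul, abs_of_pos hh]
      have h1 : h ≤ T₀ ^ (1 - ε) * h ^ ε := by
        calc h = h ^ (1 - ε) * h ^ ε := by rw [← Real.rpow_add hh, sub_add_cancel, Real.rpow_one]
          _ ≤ _ := by
            gcongr
      calc |ω| * h * Real.exp (|ω| * h) ≤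
            |ω| * (T₀ ^ (1 - ε) * h ^ ε) * Real.exp (|ω| * T₀) := by gcongr
        _ = _ := by ring
    have e4 : ‖z‖ ≤ ‖N‖ * ‖x‖ := by rw [hz, ← hN]; exact N.le_opNorm x
    calc _ ≤ Real.exp (ω * h) * ‖V h z - z‖ + |Real.exp (ω * h) - 1| * ‖z‖ := by
          rw [e1]
          refine (norm_add_le _ _).trans (le_of_eq ?_)
          rw [norm_smul, norm_smul, Real.norm_of_nonneg (Real.exp_pos _).le, Real.norm_eq_abs]
      _ ≤ Real.exp (|ω| * T₀) *
            ((Real.Gamma ε)⁻¹ * ((4 * M + 2 * C) * betaConst (1 - ε) * h ^ ε * ‖x‖)) +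
          |ω| * Real.exp (|ω| * T₀) * T₀ ^ (1 - ε) * h ^ ε * (‖N‖ * ‖x‖) := by
          have h1 := exp_mul_le (ω := ω) hh.le hhT
          gcongr
      _ = _ := by ring

end FracPow

/-! ### Regularity of the sewn path -/

lemma holderNorm_le {W : Type*} [NormedAddCommGroup W] {T γ A B : ℝ} {I : ℝ → W}
    (hA : 0 ≤ A) (hB : 0 ≤ B) (h1 : ∀ t ∈ Icc 0 T, ‖I t‖ ≤ A)
    (h2 : ∀ s t, 0 ≤ s → s < t → t ≤ T → ‖delta I t s‖ ≤ B * (t - s) ^ γ) :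
    holderNorm T γ I ≤ ENNReal.ofReal (A + B) := by
  rw [ENNReal.ofReal_add hA hB]
  refine add_le_add (iSup₂_le fun t ht => ?_) (iSup₂_le fun s t => iSup_le fun h => ?_)
  · rw [← ofReal_norm]
    exact ENNReal.ofReal_le_ofReal (h1 t ht)
  · refine ENNReal.ofReal_le_ofReal ?_
    rw [div_le_iff₀ (Real.rpow_pos_of_pos (sub_pos.2 h.2.1) _)]
    exact h2 s t h.1 h.2.1 h.2.2

lemma weightedHolderNorm_le {W : Type*} [NormedAddCommGroup W] {T γ A B : ℝ} {I : ℝ → W}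
    (hγ : 0 ≤ γ) (hA : 0 ≤ A) (hB : 0 ≤ B)
    (hT : 0 ≤ T) (h1 : ∀ t ∈ Icc 0 T, ‖I t‖ ≤ A)
    (h2 : ∀ s t, 0 ≤ s → s < t → t ≤ T → ‖delta I t s‖ ≤ B * (t - s) ^ γ) :
    weightedHolderNorm T γ I ≤ ENNReal.ofReal (A + T ^ γ * B) := by
  rw [ENNReal.ofReal_add hA (by positivity)]
  refine add_le_add (iSup₂_le fun t ht => ?_) (iSup₂_le fun s t => iSup_le fun h => ?_)
  · rw [← ofReal_norm]
    exact ENNReal.ofReal_le_ofReal (h1 t ht)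
  · have hp : 0 < (t - s) ^ γ := Real.rpow_pos_of_pos (sub_pos.2 h.2.1) _
    have hs : s ^ γ ≤ T ^ γ := Real.rpow_le_rpow h.1.le (by linarith [h.2.1, h.2.2]) hγ
    refine ENNReal.ofReal_le_ofReal (mul_le_mul hs ?_ (by positivity) (by positivity))
    rw [div_le_iff₀ hp]
    exact h2 s t h.1.le h.2.1 h.2.2

section Regularity

variable {W : Type u} [NormedAddCommGroup W] [NormedSpace ℝ W] [CompleteSpace W]
  {S : ℝ → W →L[ℝ] W} {ω α β ε γ ρ T₀ M κ C : ℝ}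

lemma rpow_le_rpow_mul_rpow {x T : ℝ} (hx : 0 ≤ x) (hxT : x ≤ T) (hγ : 0 ≤ γ) (hγα : γ ≤ α) :
    x ^ α ≤ x ^ γ * T ^ (α - γ) := by
  calc x ^ α = x ^ γ * x ^ (α - γ) := by
        rw [← Real.rpow_add_of_nonneg hx hγ (by linarith), add_sub_cancel]
    _ ≤ _ := mul_le_mul_of_nonneg_left (Real.rpow_le_rpow hx hxT (by linarith))
        (Real.rpow_nonneg hx _)

/-- The increments `hatDelta` of a path gain spatial regularity. Telescoping along the times
`t - 2⁻ᵏ (t - s)` applies the semigroup to each increment for a time as long as the increment, and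
the smoothing effect gives a geometric series because `ε < α`. -/
lemma exists_negFracPow_eq_hatDelta (hS : IsC0Semigroup S)
    (hV : IsStableAnalytic (fun t => Real.exp (-(ω * t)) • S t) M κ C)
    (hε : 0 ≤ ε) (hεα : ε < α) (hα : α ≤ 1) (T₀ : ℝ) :
    ∃ D : ℝ, 0 ≤ D ∧ ∀ (T B : ℝ) (I : ℝ → W), T ≤ T₀ → 0 ≤ B →
      (∀ s t, 0 ≤ s → s ≤ t → t ≤ T → ‖hatDelta S I t s‖ ≤ B * (t - s) ^ α) →
      ∀ s t, 0 ≤ s → s ≤ t → t ≤ T →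
        ∃ y, negFracPow S ω ε y = hatDelta S I t s ∧ ‖y‖ ≤ D * B * (t - s) ^ (α - ε) := by
  rcases hε.eq_or_lt with rfl | hε0
  · refine ⟨1, zero_le_one, fun T B I _ _ hI s t hs hst htT =>
      ⟨hatDelta S I t s, negFracPow_zero_right _, ?_⟩⟩
    simpa using hI s t hs hst htT
  obtain ⟨D, hD, hsm⟩ := exists_negFracPow_eq_apply hV hε0 (hεα.trans_le hα) T₀
  obtain ⟨N, hN⟩ := exists_clm_negFracPow hV hε
  set q : ℝ := 2 ^ (-(α - ε)) with hq
  have hq0 : 0 < q := by positivity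
  have hq1 : q < 1 := Real.rpow_lt_one_of_one_lt_of_neg one_lt_two (by linarith)
  refine ⟨D * (1 - q)⁻¹, mul_nonneg hD (inv_nonneg.2 (by linarith)),
    fun T B I hT hB hI s t hs hst htT => ?_⟩
  rcases hst.eq_or_lt with rfl | hst
  · refine ⟨0, ?_, ?_⟩
    · rw [← hN, map_zero, hatDelta, sub_self, hS.zero_apply, sub_self]
    · rw [sub_self, Real.zero_rpow (by linarith)]; simp
  have hl : 0 < t - s := sub_pos.2 hst
  set l : ℕ → ℝ := fun k => (t - s) / 2 ^ k with hl_def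
  have hl0 : ∀ k, 0 < l k := fun k => by simp only [hl_def]; positivity
  have hl1 : ∀ k, l k ≤ t - s := fun k =>
    div_le_self hl.le (one_le_pow₀ one_le_two)
  have hl2 : ∀ k, l k = 2 * l (k + 1) := fun k => by
    simp only [hl_def]; rw [pow_succ]; field_simp
  set p : ℕ → ℝ := fun k => t - l k with hp
  have hy : ∀ k, ∃ y, negFracPow S ω ε y = S (l (k + 1)) (hatDelta S I (p (k + 1)) (p k)) ∧
      ‖y‖ ≤ D * B * (t - s) ^ (α - ε) * q ^ k := by
    intro k
    obtain ⟨y, hy, hyb⟩ := hsm (l (k + 1)) (hatDelta S I (p (k + 1)) (p k)) (hl0 _)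
      ((hl1 _).trans (by linarith))
    refine ⟨y, hy, hyb.trans ?_⟩
    have h1 := hI (p k) (p (k + 1)) (by simp only [hp]; linarith [hl1 k])
      (by simp only [hp]; linarith [hl2 k, hl0 (k + 1)])
      (by simp only [hp]; linarith [hl0 (k + 1)])
    rw [show p (k + 1) - p k = l (k + 1) by simp only [hp]; linarith [hl2 k]] at h1
    have h2 : l (k + 1) ^ (-ε) * l (k + 1) ^ α = (t - s) ^ (α - ε) * q ^ (k + 1) := by
      rw [← Real.rpow_add (hl0 _), neg_add_eq_sub, hl_def, hq]
      simp only
      rw [Real.div_rpow hl.le (by positivity), ← Real.rpow_natCast, ← Real.rpow_mul two_pos.le,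
        ← Real.rpow_natCast, ← Real.rpow_mul two_pos.le, div_eq_mul_inv,
        ← Real.rpow_neg two_pos.le]
      congr 2; ring
    have h3 : 0 ≤ l (k + 1) ^ (-ε) := Real.rpow_nonneg (hl0 _).le _
    calc _ ≤ D * l (k + 1) ^ (-ε) * (B * l (k + 1) ^ α) := by gcongr
      _ = D * B * (l (k + 1) ^ (-ε) * l (k + 1) ^ α) := by ring
      _ = D * B * (t - s) ^ (α - ε) * q ^ (k + 1) := by rw [h2]; ring
      _ ≤ _ := by
        have : 0 ≤ D * B * (t - s) ^ (α - ε) := by positivity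
        gcongr D * B * (t - s) ^ (α - ε) * ?_
        exact pow_le_pow_of_le_one hq0.le hq1.le (Nat.le_succ k)
  choose y hy hyb using hy
  have hgeo := (hasSum_geometric_of_lt_one hq0.le hq1).mul_left (D * B * (t - s) ^ (α - ε))
  have hsum : Summable y := Summable.of_norm_bounded hgeo.summable hyb
  refine ⟨∑' k, y k, ?_, (tsum_of_norm_bounded hgeo hyb).trans (le_of_eq (by ring))⟩
  rw [← hN]
  have h1 := (N.hasSum hsum.hasSum).tendsto_sum_nat
  refine tendsto_nhds_unique h1 ?_
  have htel : ∀ n, ∑ k ∈ Finset.range n, N (y k) =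
      hatDelta S I t s - hatDelta S I t (p n) := by
    intro n
    have hp0 : p 0 = s := by simp [hp, hl_def]
    rw [← hp0, ← Finset.sum_range_sub' (fun k => hatDelta S I t (p k))]
    refine Finset.sum_congr rfl fun k _ => ?_
    rw [hN, hy]
    simp only [hatDelta]
    rw [map_sub, hS.apply_apply (hl0 _).le (by simp only [hp]; linarith [hl2 k, hl0 (k + 1)])]
    have e1 : t - p (k + 1) = l (k + 1) := by simp only [hp]; ring
    have e2 : l (k + 1) + (p (k + 1) - p k) = t - p k := by simp only [hp]; ring
    rw [e1, e2]
    abel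
  have h2 : Tendsto (fun n => hatDelta S I t (p n)) atTop (𝓝 0) := by
    have h3 : Tendsto l atTop (𝓝 0) := by
      have := (tendsto_pow_atTop_nhds_zero_of_lt_one (r := (1 / 2 : ℝ)) (by norm_num)
        (by norm_num)).const_mul (t - s)
      simp only [mul_zero] at this
      refine this.congr fun n => ?_
      simp [hl_def, div_eq_mul_inv]
    have h4 : Tendsto (fun n => B * l n ^ α) atTop (𝓝 0) := by
      have := (h3.rpow_const (p := α) (Or.inr (by linarith))).const_mul B
      rwa [Real.zero_rpow (by linarith), mul_zero] at this
    refine squeeze_zero_norm (fun n => ?_) h4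
    have := hI (p n) t (by simp only [hp]; linarith [hl1 n])
      (by simp only [hp]; linarith [hl0 n]) htT
    rwa [show t - p n = l n by simp only [hp]; ring] at this
  simpa [htel] using h2.const_sub (hatDelta S I t s)

/-- Time regularity of order `γ ∈ [0, α)`: the increment of the path is its `hatDelta` increment
plus the displacement of `I s` under the semigroup, and `I s ∈ D_γ`. -/
lemma exists_norm_delta_le (hS : IsC0Semigroup S)
    (hV : IsStableAnalytic (fun t => Real.exp (-(ω * t)) • S t) M κ C)
    (hγ : 0 ≤ γ) (hγα : γ < α) (hα : α ≤ 1) (hT₀ : 0 < T₀) :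
    ∃ D : ℝ, 0 ≤ D ∧ ∀ (T B : ℝ) (I : ℝ → W), T ≤ T₀ → 0 ≤ B → I 0 = 0 →
      (∀ s t, 0 ≤ s → s ≤ t → t ≤ T → ‖hatDelta S I t s‖ ≤ B * (t - s) ^ α) →
      ∀ s t, 0 ≤ s → s ≤ t → t ≤ T →
        ‖delta I t s‖ ≤ D * B * (t - s) ^ γ * T ^ (α - γ) := by
  obtain ⟨D₁, hD₁, h₁⟩ := exists_negFracPow_eq_hatDelta hS hV hγ hγα hα T₀
  obtain ⟨D₂, hD₂, h₂⟩ :=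
    exists_norm_apply_negFracPow_sub_le hS hV hγ (hγα.trans_le hα) hT₀
  refine ⟨1 + D₂ * D₁, by positivity, fun T B I hT hB hI0 hI s t hs hst htT => ?_⟩
  have hsT : s ≤ T := hst.trans htT
  obtain ⟨y, hy, hyb⟩ := h₁ T B I hT hB hI 0 s le_rfl hs hsT
  have hyI : negFracPow S ω γ y = I s := by rw [hy, hatDelta, hI0, map_zero, sub_zero]
  have e1 := h₂ (t - s) y (by linarith) (by linarith)
  rw [hyI] at e1
  have e2 := hI s t hs hst htT
  have e3 := rpow_le_rpow_mul_rpow (x := t - s) (T := T) (by linarith) (by linarith) hγ hγα.le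
  have e4 : (s - 0) ^ (α - γ) ≤ T ^ (α - γ) :=
    Real.rpow_le_rpow (by linarith) (by linarith) (by linarith)
  have hnn : 0 ≤ (t - s) ^ γ := Real.rpow_nonneg (by linarith) _
  calc ‖delta I t s‖ = ‖hatDelta S I t s + (S (t - s) (I s) - I s)‖ := by
        rw [delta, hatDelta]; congr 1; abel
    _ ≤ B * (t - s) ^ α + D₂ * (t - s) ^ γ * ‖y‖ := (norm_add_le _ _).trans (add_le_add e2 e1)
    _ ≤ B * ((t - s) ^ γ * T ^ (α - γ)) +
        D₂ * (t - s) ^ γ * (D₁ * B * T ^ (α - γ)) := by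
        gcongr
        exact hyb.trans (mul_le_mul_of_nonneg_left e4 (by positivity))
    _ = _ := by ring

/-- Every sewn path satisfies the a priori bound with a constant that does not depend on the
data, since it coincides with the path constructed above. -/
lemma exists_norm_hatDelta_le (hS : IsC0Semigroup S) (hω : GrowthBoundLT S ω) (hα : 0 < α)
    (hβ : 0 ≤ β) (hρ : 1 < ρ) (hαβρ : α + β ≤ ρ) (T₀ : ℝ) :
    ∃ K : ℝ, 0 ≤ K ∧ ∀ (T c₁ c₂ : ℝ) (Ξ : ℝ → ℝ → W) (I : ℝ → W), 0 < T → T ≤ T₀ →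
      IsApproximationTerm S T α β ρ c₁ c₂ Ξ → IsSewing S T α β ρ c₁ c₂ Ξ I →
        ∀ s t : ℝ, 0 ≤ s → s ≤ t → t ≤ T →
          ‖hatDelta S I t s‖ ≤ K * (c₁ + c₂) * (t - s) ^ α := by
  obtain ⟨K, hK, hex⟩ := exists_isSewing_uniform hS hω hα hβ hρ hαβρ T₀
  refine ⟨K, hK, fun T c₁ c₂ Ξ I hT hTT₀ hΞ hI s t hs hst htT => ?_⟩
  obtain ⟨J, hJc, hJ0, hJ1, hJ2⟩ := hex T c₁ c₂ Ξ hT hTT₀ hΞ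
  have heq := IsSewing.eqOn hS hω hρ hβ ⟨hJc, hJ0, K, hJ1, hJ2⟩ hI
  have := hJ1 s t hs hst htT
  rwa [hatDelta, ← heq ⟨hs, hst.trans htT⟩, ← heq ⟨hs.trans hst, htT⟩] at this

end Regularity

end MildSewing

end

theorem mainTheorem7 {W : Type*} [NormedAddCommGroup W] [NormedSpace ℝ W] [CompleteSpace W]
    (S : ℝ → W →L[ℝ] W) (hS : MildSewing.IsAnalyticSemigroup S)
    (ω : ℝ) (hω : MildSewing.GrowthBoundLT S ω)
    (α β ρ : ℝ) (hα₀ : 0 < α) (hα₁ : α ≤ 1) (hβ₀ : 0 ≤ β) (hβ₁ : β ≤ 1)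
    (hρ : 1 < ρ) (hαβρ : α + β ≤ ρ) (T₀ : ℝ) :
    (∀ (T c₁ c₂ : ℝ) (Ξ : ℝ → ℝ → W), 0 < T →
      MildSewing.IsApproximationTerm S T α β ρ c₁ c₂ Ξ →
        ∃ I : ℝ → W, MildSewing.IsSewing S T α β ρ c₁ c₂ Ξ I ∧
          ∀ J : ℝ → W, MildSewing.IsSewing S T α β ρ c₁ c₂ Ξ J → Set.EqOn J I (Set.Icc 0 T)) ∧
    (∀ ε : ℝ, 0 ≤ ε → ε < α → ∃ C : ℝ,
      ∀ (T c₁ c₂ : ℝ) (Ξ : ℝ → ℝ → W) (I : ℝ → W), 0 < T → T ≤ T₀ →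
        MildSewing.IsApproximationTerm S T α β ρ c₁ c₂ Ξ →
        MildSewing.IsSewing S T α β ρ c₁ c₂ Ξ I →
          ∀ s t : ℝ, 0 ≤ s → s ≤ t → t ≤ T →
            MildSewing.hatDelta S I t s ∈ MildSewing.fracDomain S ω ε ∧
            MildSewing.fracNorm S ω ε (MildSewing.hatDelta S I t s) ≤
              C * (c₁ + c₂) * (t - s) ^ (α - ε)) ∧
    (∀ γ : ℝ, γ < α → ∃ C : ℝ,
      ∀ (T c₁ c₂ : ℝ) (Ξ : ℝ → ℝ → W) (I : ℝ → W), 0 < T → T ≤ T₀ →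
        MildSewing.IsApproximationTerm S T α β ρ c₁ c₂ Ξ →
        MildSewing.IsSewing S T α β ρ c₁ c₂ Ξ I →
          ∀ s t : ℝ, 0 ≤ s → s ≤ t → t ≤ T →
            ‖MildSewing.delta I t s‖ ≤ C * (c₁ + c₂) * (t - s) ^ γ * T ^ (α - γ)) ∧
    (∀ γ : ℝ, 0 ≤ γ → γ < α → ∃ C : ℝ,
      ∀ (T c₁ c₂ : ℝ) (Ξ : ℝ → ℝ → W) (I : ℝ → W), 0 < T → T ≤ T₀ →
        MildSewing.IsApproximationTerm S T α β ρ c₁ c₂ Ξ →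
        MildSewing.IsSewing S T α β ρ c₁ c₂ Ξ I →
          MildSewing.holderNorm T γ I ≤ ENNReal.ofReal (C * (c₁ + c₂) * T ^ (α - γ)) ∧
          MildSewing.weightedHolderNorm T γ I ≤ ENNReal.ofReal (C * (c₁ + c₂) * T ^ α)) := by
  have hS' := hS.toIsC0Semigroup
  obtain ⟨M, κ, C, hV⟩ := hS.exists_isStableAnalytic hω
  -- a positive upper bound for the time horizons
  obtain ⟨T₁, hT₁, hT₀₁⟩ : ∃ T₁ : ℝ, 0 < T₁ ∧ T₀ ≤ T₁ :=
    ⟨max T₀ 1, lt_max_of_lt_right one_pos, le_max_left _ _⟩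
  obtain ⟨K, hK, hbd⟩ := MildSewing.exists_norm_hatDelta_le hS' hω hα₀ hβ₀ hρ hαβρ T₁
  refine ⟨fun T c₁ c₂ Ξ hT hΞ => ?_, fun ε hε hεα => ?_, fun γ hγα => ?_, fun γ hγ hγα => ?_⟩
  · obtain ⟨K', -, hex⟩ := MildSewing.exists_isSewing_uniform hS' hω hα₀ hβ₀ hρ hαβρ T
    obtain ⟨I, hIc, hI0, hI1, hI2⟩ := hex T c₁ c₂ Ξ hT le_rfl hΞ
    exact ⟨I, ⟨hIc, hI0, K', hI1, hI2⟩, fun J hJ =>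
      MildSewing.IsSewing.eqOn hS' hω hρ hβ₀ ⟨hIc, hI0, K', hI1, hI2⟩ hJ⟩
  · obtain ⟨D, hD, h⟩ := MildSewing.exists_negFracPow_eq_hatDelta hS' hV hε hεα hα₁ T₁
    refine ⟨D * K, fun T c₁ c₂ Ξ I hT hTT₀ hΞ hI s t hs hst htT => ?_⟩
    obtain ⟨y, hy, hyb⟩ := h T (K * (c₁ + c₂)) I (hTT₀.trans hT₀₁)
      (mul_nonneg hK (add_nonneg (hΞ.c₁_nonneg hT) (hΞ.c₂_nonneg hT)))
      (hbd T c₁ c₂ Ξ I hT (hTT₀.trans hT₀₁) hΞ hI) s t hs hst htT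
    refine ⟨⟨y, hy⟩, ?_⟩
    rw [MildSewing.fracNorm, MildSewing.fracPow, ← hy,
      Function.leftInverse_invFun
        (MildSewing.negFracPow_injective hV hε (hεα.trans_le hα₁)) y]
    exact hyb.trans (le_of_eq (by ring))
  · rcases le_or_gt 0 γ with hγ | hγ
    · obtain ⟨D, hD, h⟩ := MildSewing.exists_norm_delta_le hS' hV hγ hγα hα₁ hT₁
      refine ⟨D * K, fun T c₁ c₂ Ξ I hT hTT₀ hΞ hI s t hs hst htT => ?_⟩
      refine (h T (K * (c₁ + c₂)) I (hTT₀.trans hT₀₁)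
        (mul_nonneg hK (add_nonneg (hΞ.c₁_nonneg hT) (hΞ.c₂_nonneg hT))) hI.map_zero
        (hbd T c₁ c₂ Ξ I hT (hTT₀.trans hT₀₁) hΞ hI) s t hs hst htT).trans (le_of_eq (by ring))
    -- for negative `γ` the bound is weaker than the one for exponent `0`
    · obtain ⟨D, hD, h⟩ := MildSewing.exists_norm_delta_le hS' hV le_rfl hα₀ hα₁ hT₁
      refine ⟨D * K, fun T c₁ c₂ Ξ I hT hTT₀ hΞ hI s t hs hst htT => ?_⟩
      have hc : 0 ≤ c₁ + c₂ := add_nonneg (hΞ.c₁_nonneg hT) (hΞ.c₂_nonneg hT)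
      have h0 := h T (K * (c₁ + c₂)) I (hTT₀.trans hT₀₁) (mul_nonneg hK hc) hI.map_zero
        (hbd T c₁ c₂ Ξ I hT (hTT₀.trans hT₀₁) hΞ hI) s t hs hst htT
      rw [Real.rpow_zero, mul_one, sub_zero] at h0
      rcases hst.eq_or_lt with rfl | hst
      · rw [MildSewing.delta, sub_self, norm_zero, sub_self, Real.zero_rpow hγ.ne]
        simp
      · have hp : 0 < t - s := sub_pos.2 hst
        have h1 : T ^ α ≤ (t - s) ^ γ * T ^ (α - γ) := by
          calc T ^ α = T ^ γ * T ^ (α - γ) := by rw [← Real.rpow_add hT, add_sub_cancel]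
            _ ≤ _ := mul_le_mul_of_nonneg_right
                (Real.rpow_le_rpow_of_nonpos hp (by linarith) hγ.le) (Real.rpow_nonneg hT.le _)
        calc _ ≤ D * (K * (c₁ + c₂)) * T ^ α := h0
          _ ≤ D * (K * (c₁ + c₂)) * ((t - s) ^ γ * T ^ (α - γ)) := by gcongr
          _ = _ := by ring
  · obtain ⟨D, hD, h⟩ := MildSewing.exists_norm_delta_le hS' hV hγ hγα hα₁ hT₁
    refine ⟨(1 + T₁ ^ γ + D) * K, fun T c₁ c₂ Ξ I hT hTT₀ hΞ hI => ?_⟩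
    have hc : 0 ≤ c₁ + c₂ := add_nonneg (hΞ.c₁_nonneg hT) (hΞ.c₂_nonneg hT)
    set B := K * (c₁ + c₂) with hB
    have hB0 : 0 ≤ B := mul_nonneg hK hc
    have hbdI := hbd T c₁ c₂ Ξ I hT (hTT₀.trans hT₀₁) hΞ hI
    have hsup : ∀ t ∈ Set.Icc 0 T, ‖I t‖ ≤ B * T ^ α := fun t ht => by
      have h1 := hbdI 0 t le_rfl ht.1 ht.2
      rw [MildSewing.hatDelta, hI.map_zero, map_zero, sub_zero, sub_zero] at h1
      exact h1.trans (mul_le_mul_of_nonneg_left (Real.rpow_le_rpow ht.1 ht.2 hα₀.le) hB0)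
    have hinc : ∀ s t, 0 ≤ s → s < t → t ≤ T →
        ‖MildSewing.delta I t s‖ ≤ D * B * T ^ (α - γ) * (t - s) ^ γ := fun s t hs hst htT =>
      (h T B I (hTT₀.trans hT₀₁) hB0 hI.map_zero hbdI s t hs hst.le htT).trans
        (le_of_eq (by ring))
    have hTα : T ^ γ * T ^ (α - γ) = T ^ α := by rw [← Real.rpow_add hT, add_sub_cancel]
    have hTγ : T ^ γ ≤ T₁ ^ γ := Real.rpow_le_rpow hT.le (hTT₀.trans hT₀₁) hγ
    refine ⟨(MildSewing.holderNorm_le (by positivity) (by positivity) hsup hinc).trans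
      (ENNReal.ofReal_le_ofReal ?_),
      (MildSewing.weightedHolderNorm_le hγ (by positivity) (by positivity) hT.le hsup hinc).trans
      (ENNReal.ofReal_le_ofReal ?_)⟩
    · calc B * T ^ α + D * B * T ^ (α - γ) = (T ^ γ + D) * B * T ^ (α - γ) := by
            rw [← hTα]; ring
        _ ≤ (1 + T₁ ^ γ + D) * B * T ^ (α - γ) := by gcongr; linarith
        _ = _ := by rw [hB]; ring
    · calc B * T ^ α + T ^ γ * (D * B * T ^ (α - γ)) = (1 + D) * B * T ^ α := by
            rw [← hTα]; ring
        _ ≤ (1 + T₁ ^ γ + D) * B * T ^ α := by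
            have : 0 ≤ T₁ ^ γ := Real.rpow_nonneg hT₁.le _
            gcongr
            linarith
        _ = _ := by rw [hB]; ring
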